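/- Let $\Omega=\mathbb R\times[0,1]$ and $\Omega_0=(-\tfrac12,\tfrac12]\times[0,1]$. Let $k\in\mathbb R$, let $q\in L^\infty(\Omega)$ be real-valued and $1$-periodic in $x_1$ with $q\ge C>0$, and let $f\in L^2(\Omega)$ vanish outside $\Omega_0$. For $z\in\mathbb C\setminus\{0\}$ let $H^1_z(\Omega_0)$ be the space of all $\phi\in H^1(\Omega_0)$ whose $z$-quasi-periodic extension $(x_1+n,x_2)\mapsto z^n\phi(x_1,x_2)$ ($x\in\Omega_0$, $n\in\mathbb Z$) belongs to $H^1_{loc}(\Omega)$. Consider the quasi-periodic cell problem: find $w(z,\cdot)\in H^1_z(\Omega_0)$ with $$\Delta w(z,\cdot)+k^2q\,w(z,\cdot)=f\ \text{ in }\Omega_0,\qquad \frac{\partial w(z,\cdot)}{\partial x_2}=0\ \text{ on the walls } x_2\in\{0,1\},$$ in the weak sense, that is, $$\int_{\Omega_0}\big(\nabla w(z,\cdot)\cdot\nabla\phi-k^2q\,w(z,\cdot)\,\phi\big)\,dx=-\int_{\Omega_0}f\phi\,dx\qquad\text{for all }\phi\in H^1_{z^{-1}}(\Omega_0).$$ Let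 $\mathbb F\subset\mathbb C\setminus\{0\}$ be the set of Floquet multipliers, i.e. of those $z\ne0$ for which this problem with $f=0$ has a nontrivial solution in $H^1_z(\Omega_0)$. Theorem. The set $\mathbb F$ has no accumulation point in $\mathbb C\setminus\{0\}$. For every $z\in\mathbb C\setminus(\mathbb F\cup\{0\})$ the cell problem has exactly one solution $w(z,\cdot)$. As a function of $z$ with values in $H^1(\Omega_0)$, $w$ depends analytically on $z\in\mathbb C\setminus(\mathbb F\cup\{0\})$ (near every point it is the sum of a power series in $z$ with coefficients in $H^1(\Omega_0)$, convergent in the $H^1(\Omega_0)$ norm), and it is meromorphic in $\mathbb C\setminus\{0\}$. -/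

import Mathlib

open MeasureTheory Filter Topology
open scoped ContDiff ENNReal

noncomputable section

namespace Waveguide

/-- The interior `ℝ × (0, 1)` of the waveguide. -/
def strip : Set (ℝ × ℝ) := Set.univ ×ˢ Set.Ioo 0 1

/-- The interior `(-1/2, 1/2) × (0, 1)` of the periodicity cell. The boundary is a null set, so it
plays no role for the Lebesgue spaces. -/
def cell : Set (ℝ × ℝ) := Set.Ioo (-1 / 2) (1 / 2) ×ˢ Set.Ioo 0 1

/-- Lebesgue measure on the periodicity cell. -/
abbrev cellMeasure : Measure (ℝ × ℝ) := volume.restrict cell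

/-- `g` is the weak derivative of `u` in the direction `e` on the open set `U`. -/
def IsWeakDeriv (U : Set (ℝ × ℝ)) (e : ℝ × ℝ) (u g : ℝ × ℝ → ℂ) : Prop :=
  ∀ φ : ℝ × ℝ → ℝ, ContDiff ℝ ∞ φ → HasCompactSupport φ → tsupport φ ⊆ U →
    ∫ x in U, (fderiv ℝ φ x e) • u x = -∫ x in U, φ x • g x

theorem integrable_smul_of_memLp {v : ℝ × ℝ → ℂ} (hv : MemLp v 2 cellMeasure)
    {ψ : ℝ × ℝ → ℝ} (hψ : Continuous ψ) (hc : HasCompactSupport ψ) :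
    Integrable (fun x => ψ x • v x) cellMeasure := by
  have h := (hψ.memLp_of_hasCompactSupport (μ := cellMeasure) (p := 2) hc)
  exact memLp_one_iff_integrable.1 (hv.smul h)

theorem continuous_fderiv_apply_of_smooth {φ : ℝ × ℝ → ℝ} (h : ContDiff ℝ ∞ φ) (e : ℝ × ℝ) :
    Continuous fun x => fderiv ℝ φ x e :=
  (h.continuous_fderiv (by simp)).clm_apply continuous_const

theorem IsWeakDeriv.congr {U : Set (ℝ × ℝ)} {e : ℝ × ℝ} {u u' g g' : ℝ × ℝ → ℂ}
    (h : IsWeakDeriv U e u g) (hu : u =ᵐ[volume.restrict U] u')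
    (hg : g =ᵐ[volume.restrict U] g') : IsWeakDeriv U e u' g' := by
  intro φ h1 h2 h3
  have a : ∫ x in U, (fderiv ℝ φ x e) • u' x = ∫ x in U, (fderiv ℝ φ x e) • u x :=
    integral_congr_ae (hu.mono fun x hx => by simp only [hx])
  have b : ∫ x in U, φ x • g' x = ∫ x in U, φ x • g x :=
    integral_congr_ae (hg.mono fun x hx => by simp only [hx])
  rw [a, b, h φ h1 h2 h3]

theorem IsWeakDeriv.add_cell {e : ℝ × ℝ} {u u' g g' : ℝ × ℝ → ℂ}
    (h : IsWeakDeriv cell e u g) (h' : IsWeakDeriv cell e u' g')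
    (hu : MemLp u 2 cellMeasure) (hu' : MemLp u' 2 cellMeasure)
    (hg : MemLp g 2 cellMeasure) (hg' : MemLp g' 2 cellMeasure) :
    IsWeakDeriv cell e (u + u') (g + g') := by
  intro φ h1 h2 h3
  have c := continuous_fderiv_apply_of_smooth h1 e
  have s : HasCompactSupport fun x => fderiv ℝ φ x e := h2.fderiv_apply ℝ e
  simp only [Pi.add_apply, smul_add]
  rw [integral_add (integrable_smul_of_memLp hu c s) (integrable_smul_of_memLp hu' c s),
    integral_add (integrable_smul_of_memLp hg h1.continuous h2)
      (integrable_smul_of_memLp hg' h1.continuous h2), h φ h1 h2 h3, h' φ h1 h2 h3]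
  ring

theorem IsWeakDeriv.const_smul {U : Set (ℝ × ℝ)} {e : ℝ × ℝ} {u g : ℝ × ℝ → ℂ}
    (h : IsWeakDeriv U e u g) (c : ℂ) : IsWeakDeriv U e (c • u) (c • g) := by
  intro φ h1 h2 h3
  simp only [Pi.smul_apply]
  simp_rw [smul_comm _ c]
  rw [integral_smul, integral_smul, h φ h1 h2 h3, smul_neg]

theorem isWeakDeriv_zero (U : Set (ℝ × ℝ)) (e : ℝ × ℝ) : IsWeakDeriv U e 0 0 := by
  intro φ _ _ _
  simp

/-- The Sobolev space `H¹` of the cell with its standard (Hilbert) norm: the triples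
`w = (w 0, w 1, w 2)` in `L²` for which `w 1`, `w 2` are the weak derivatives `∂₁ (w 0)`,
`∂₂ (w 0)`. -/
def H1 : Submodule ℂ (PiLp 2 fun _ : Fin 3 => Lp ℂ 2 cellMeasure) where
  carrier := {w | IsWeakDeriv cell (1, 0) (w 0) (w 1) ∧ IsWeakDeriv cell (0, 1) (w 0) (w 2)}
  zero_mem' := by
    have z := (Lp.coeFn_zero ℂ 2 cellMeasure).symm
    exact ⟨(isWeakDeriv_zero cell (1, 0)).congr z z, (isWeakDeriv_zero cell (0, 1)).congr z z⟩
  add_mem' := by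
    rintro a b ⟨ha1, ha2⟩ ⟨hb1, hb2⟩
    have z := fun i => (Lp.coeFn_add (a i) (b i)).symm
    exact ⟨(ha1.add_cell hb1 (Lp.memLp _) (Lp.memLp _) (Lp.memLp _) (Lp.memLp _)).congr (z 0) (z 1),
      (ha2.add_cell hb2 (Lp.memLp _) (Lp.memLp _) (Lp.memLp _) (Lp.memLp _)).congr (z 0) (z 2)⟩
  smul_mem' := by
    rintro c a ⟨ha1, ha2⟩
    have z := fun i => (Lp.coeFn_smul c (a i)).symm
    exact ⟨(ha1.const_smul c).congr (z 0) (z 1), (ha2.const_smul c).congr (z 0) (z 2)⟩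

/-- The function underlying an element of `H¹` of the cell. -/
def fn (w : H1) : ℝ × ℝ → ℂ := (w : PiLp 2 fun _ : Fin 3 => Lp ℂ 2 cellMeasure) 0

/-- The weak derivative `∂₁ w`. -/
def d1 (w : H1) : ℝ × ℝ → ℂ := (w : PiLp 2 fun _ : Fin 3 => Lp ℂ 2 cellMeasure) 1

/-- The weak derivative `∂₂ w`. -/
def d2 (w : H1) : ℝ × ℝ → ℂ := (w : PiLp 2 fun _ : Fin 3 => Lp ℂ 2 cellMeasure) 2

/-- Square integrable on each bounded piece `(-R, R) × (0, 1)` of the waveguide. -/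
def MemL2Loc (u : ℝ × ℝ → ℂ) : Prop :=
  ∀ R : ℝ, MemLp u 2 (volume.restrict (Set.Ioo (-R) R ×ˢ Set.Ioo 0 1))

/-- `u` is an `H¹_loc` function on the waveguide `ℝ × [0, 1]` (locally `H¹` up to the walls). -/
def MemH1Loc (u : ℝ × ℝ → ℂ) : Prop :=
  MemL2Loc u ∧ ∃ g₁ g₂ : ℝ × ℝ → ℂ, MemL2Loc g₁ ∧ MemL2Loc g₂ ∧
    IsWeakDeriv strip (1, 0) u g₁ ∧ IsWeakDeriv strip (0, 1) u g₂

/-- The `z`-quasi-periodic extension `(x₁ + n, x₂) ↦ z ^ n φ (x₁, x₂)`, for `-1/2 < x₁ ≤ 1/2` and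
`n : ℤ`. -/
def qpExtend (z : ℂ) (φ : ℝ × ℝ → ℂ) (x : ℝ × ℝ) : ℂ :=
  z ^ ⌈x.1 - 1 / 2⌉ * φ (x.1 - ⌈x.1 - 1 / 2⌉, x.2)

/-- Membership in the `z`-quasi-periodic space `H¹_z` of the cell. -/
def IsQuasiPeriodic (z : ℂ) (w : H1) : Prop := MemH1Loc (qpExtend z (fn w))

/-- `w` is a (weak) solution in `H¹_z` of `Δ w + k² q w = f` in the cell with `∂w/∂x₂ = 0` on the
walls. The test functions are `z⁻¹`-quasi-periodic, so that the contributions of the left and right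
sides of the cell cancel. -/
def IsSolution (k : ℝ) (q : ℝ × ℝ → ℝ) (f : ℝ × ℝ → ℂ) (z : ℂ) (w : H1) : Prop :=
  IsQuasiPeriodic z w ∧ ∀ φ : H1, IsQuasiPeriodic z⁻¹ φ →
    ∫ x in cell, (d1 w x * d1 φ x + d2 w x * d2 φ x - (k : ℂ) ^ 2 * (q x : ℂ) * fn w x * fn φ x) =
      -∫ x in cell, f x * fn φ x

/-- The Floquet multipliers: the `z ≠ 0` for which the homogeneous problem has a nontrivial
solution in `H¹_z`. -/
def floquetMultipliers (k : ℝ) (q : ℝ × ℝ → ℝ) : Set ℂ :=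
  {z | z ≠ 0 ∧ ∃ w : H1, w ≠ 0 ∧ IsSolution k q 0 z w}

end Waveguide

end

/-! Write `z = -exp a` and `w = exp (a x₁) u`. Then `w` is `z`-quasi-periodic exactly when `u` is
antiperiodic, so the unknowns live in one space `V` that does not depend on `z`. As `-1` is its own
inverse, the test functions become `exp (-a x₁)` times conjugates of elements of `V`. In `V` the
cell problem reads `u + lowerOrder m a (D 0 u) = rhs F a` (`isSolution_gauge_iff`): the identity
comes from the `H¹` inner product, and what is left is polynomial in `a` and sees `u` only through
the embedding `D 0` into `L²`.

This embedding is a norm limit of finite rank operators, because on squares of side `1 / n` a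
function in `H¹` is close to a constant, with error of order `1 / n` times its gradient
(`exists_finite_rank_approx`). Near each exponent the inverse of the operator is therefore a
quotient of an analytic operator family by an analytic scalar `d`, and a zero of `d` produces a
kernel (`exists_analytic_cramer`). So a nontrivial kernel occurs either on a whole neighbourhood of
an exponent or nowhere on a punctured one. As `ℂ` is connected, the first case is excluded
everywhere once a single exponent has trivial kernel (`eventually_injective`).

Such an exponent comes from Thomas' argument (`exists_injective`). On antiperiodic functions `∂₁`
has a bounded skew-adjoint inverse, `primitive`; on periodic functions the constants would prevent
this. For real `a = t`, testing the homogeneous equation with the primitive of `u` and taking real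
parts gives `2 t ‖u‖² = Re ⟨primitive u, m u⟩`, which forces `u = 0` for large `t`. Finally, a local
analytic logarithm carries everything from `a` back to `z`. -/

namespace Waveguide

/-! ### Analytic Fredholm theory by Cramer's rule -/

section Fredholm

variable {E H : Type*} [NormedAddCommGroup E] [NormedSpace ℂ E] [CompleteSpace E]
  [NormedAddCommGroup H] [InnerProductSpace ℂ H]

theorem analyticAt_clm_apply {F G : Type*} [NormedAddCommGroup F] [NormedSpace ℂ F]
    [NormedAddCommGroup G] [NormedSpace ℂ G] {T : ℂ → F →L[ℂ] G} {v : ℂ → F} {a : ℂ}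
    (hT : AnalyticAt ℂ T a) (hv : AnalyticAt ℂ v a) : AnalyticAt ℂ (fun x => T x (v x)) a :=
  AnalyticAt.comp₂ (h := fun p : (F →L[ℂ] G) × F => p.1 p.2)
    ((ContinuousLinearMap.id ℂ (F →L[ℂ] G)).analyticAt_bilinear (T a, v a)) hT hv

theorem analyticAt_comp_left {F G K : Type*} [NormedAddCommGroup F] [NormedSpace ℂ F]
    [NormedAddCommGroup G] [NormedSpace ℂ G] [NormedAddCommGroup K] [NormedSpace ℂ K]
    (S : G →L[ℂ] K) {T : ℂ → F →L[ℂ] G} {a : ℂ} (hT : AnalyticAt ℂ T a) :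
    AnalyticAt ℂ (fun x => S.comp (T x)) a :=
  ((ContinuousLinearMap.compL ℂ F G K S).analyticAt _).comp hT

/-- `ι` is a norm limit of its compressions to finite-dimensional subspaces. -/
def FiniteRankApproximable (ι : E →L[ℂ] H) : Prop :=
  ∀ ε : ℝ, 0 < ε → ∃ (n : ℕ) (e : Fin n → H), ∀ u, ‖ι u - ∑ j, inner ℂ (e j) (ι u) • e j‖ ≤ ε * ‖u‖

/-- The Cramer rule for the inverse of an analytic family `1 + L a ∘ ι`, with `ι` approximable by
finite rank operators. -/
theorem exists_analytic_cramer {ι : E →L[ℂ] H} (hι : FiniteRankApproximable ι)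
    {L : ℂ → H →L[ℂ] E} {a₀ : ℂ} (hL : AnalyticAt ℂ L a₀) :
    ∃ (d : ℂ → ℂ) (N : ℂ → E →L[ℂ] E), AnalyticAt ℂ d a₀ ∧ AnalyticAt ℂ N a₀ ∧
      ∀ᶠ a in 𝓝 a₀, (∀ u, d a • u = N a (u + L a (ι u))) ∧
        (∀ v, N a v + L a (ι (N a v)) = d a • v) ∧
        (d a = 0 → ∃ u, u ≠ 0 ∧ u + L a (ι u) = 0) := by
  -- The tolerance gives the remainder `R` of the approximation `‖L a₀ ∘ R‖ < 1`, so `1 + L a ∘ R`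
  -- is invertible at `a₀` and, units being open, near it. The `+ 1` keeps the denominator positive.
  obtain ⟨n, e, he⟩ := hι (1 / (2 * (‖L a₀‖ + 1))) (by positivity)
  let p : Fin n → E →L[ℂ] ℂ := fun j => (innerSL ℂ (e j)).comp ι
  let R : E →L[ℂ] H := ι - ∑ j, (p j).smulRight (e j)
  have hR : ‖R‖ ≤ 1 / (2 * (‖L a₀‖ + 1)) := by
    refine R.opNorm_le_bound (by positivity) fun u => ?_
    simpa [R, p] using he u
  have hιR : ∀ u, ι u = R u + ∑ j, p j u • e j := fun u => by simp [R]
  let G : ℂ → E →L[ℂ] E := fun a => 1 + (L a).comp R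
  have hG : AnalyticAt ℂ G a₀ :=
    analyticAt_const.add
      ((((ContinuousLinearMap.compL ℂ E H E).flip R).analyticAt _).comp hL)
  have hGu : IsUnit (G a₀) := by
    have : ‖-((L a₀).comp R)‖ < 1 := by
      rw [norm_neg]
      calc ‖(L a₀).comp R‖ ≤ ‖L a₀‖ * ‖R‖ := ContinuousLinearMap.opNorm_comp_le _ _
        _ ≤ ‖L a₀‖ * (1 / (2 * (‖L a₀‖ + 1))) := by gcongr
        _ < 1 := by
          rw [mul_one_div, div_lt_one (by positivity)]
          linarith [norm_nonneg (L a₀)]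
    simpa [G] using isUnit_one_sub_of_norm_lt_one this
  let I : ℂ → E →L[ℂ] E := fun a => Ring.inverse (G a)
  have hI : AnalyticAt ℂ I a₀ := by
    obtain ⟨g, hg⟩ := hGu
    have : AnalyticAt ℂ Ring.inverse (G a₀) := hg ▸ analyticAt_inverse g
    exact this.comp hG
  have hunit : ∀ᶠ a in 𝓝 a₀, IsUnit (G a) :=
    hG.continuousAt.eventually (Units.isOpen.mem_nhds hGu)
  -- Applying `I a` and then `p i` to `G a u + ∑ j, p j u • L a (e j) = v` leaves a linear system
  -- for the numbers `p j u`, with matrix `Mt a`.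
  let Mt : ℂ → Matrix (Fin n) (Fin n) ℂ := fun a =>
    Matrix.of fun i j => (if i = j then 1 else 0) + p i (I a (L a (e j)))
  have hLe : ∀ j, AnalyticAt ℂ (fun a => L a (e j)) a₀ := fun j => analyticAt_clm_apply hL analyticAt_const
  have hILe : ∀ j, AnalyticAt ℂ (fun a => I a (L a (e j))) a₀ := fun j => analyticAt_clm_apply hI (hLe j)
  have hM : ∀ i j, AnalyticAt ℂ (fun a => Mt a i j) a₀ := fun i j =>
    analyticAt_const.add (((p i).analyticAt _).comp (hILe j))
  have hdet : ∀ T : ℂ → Matrix (Fin n) (Fin n) ℂ, (∀ i j, AnalyticAt ℂ (fun a => T a i j) a₀) →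
      AnalyticAt ℂ (fun a => (T a).det) a₀ := by
    intro T hT
    simp only [Matrix.det_apply]
    refine Finset.analyticAt_fun_sum _ fun σ _ => ?_
    have : AnalyticAt ℂ (fun a => ∏ i, T a (σ i) i) a₀ :=
      Finset.analyticAt_fun_prod _ fun i _ => hT _ _
    simp only [Units.smul_def, zsmul_eq_mul]
    exact analyticAt_const.mul this
  have hadj : ∀ i j, AnalyticAt ℂ (fun a => (Mt a).adjugate i j) a₀ := by
    intro i j
    simp only [Matrix.adjugate_apply]
    refine hdet _ fun k l => ?_
    by_cases hk : k = j
    · subst hk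
      simp only [Matrix.updateRow_self]
      exact analyticAt_const
    · simp only [Matrix.updateRow_ne hk]
      exact hM k l
  let c : ℂ → Fin n → E →L[ℂ] ℂ := fun a j => ∑ l, (Mt a).adjugate j l • (p l).comp (I a)
  have hc : ∀ j, AnalyticAt ℂ (fun a => c a j) a₀ := fun j =>
    Finset.analyticAt_fun_sum _ fun l _ => (hadj j l).smul
      (((ContinuousLinearMap.compL ℂ E E ℂ (p l)).analyticAt _).comp hI)
  -- This is `det (Mt a)` times the solution operator: the adjugate stands in for the inverse
  -- matrix, so `N` is analytic also where the determinant vanishes.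
  let N : ℂ → E →L[ℂ] E := fun a =>
    (Mt a).det • I a - ∑ j, (c a j).smulRight (I a (L a (e j)))
  refine ⟨fun a => (Mt a).det, N, hdet _ hM, ?_, ?_⟩
  · refine ((hdet _ hM).smul hI).sub (Finset.analyticAt_fun_sum _ fun j _ => ?_)
    exact analyticAt_clm_apply (((ContinuousLinearMap.smulRightL ℂ E E).analyticAt _).comp (hc j))
      (hILe j)
  filter_upwards [hunit] with a ha
  have hIG : ∀ u, I a (G a u) = u := fun u => by
    have := Ring.inverse_mul_cancel _ ha
    exact congrArg (fun T : E →L[ℂ] E => T u) this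
  have hGI : ∀ u, G a (I a u) = u := fun u => by
    have := Ring.mul_inverse_cancel _ ha
    exact congrArg (fun T : E →L[ℂ] E => T u) this
  have hA : ∀ u, u + L a (ι u) = G a u + ∑ j, p j u • L a (e j) := fun u => by
    rw [hιR u]; simp [G, add_assoc]
  have hMp : ∀ (i : Fin n) (x : Fin n → ℂ),
      (Mt a).mulVec x i = x i + ∑ j, x j * p i (I a (L a (e j))) := by
    intro i x
    simp [Matrix.mulVec, dotProduct, Mt, add_mul, Finset.sum_add_distrib]
    exact Finset.sum_congr rfl fun j _ => mul_comm _ _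
  have hcv : ∀ v j, c a j v = (Mt a).adjugate.mulVec (fun l => p l (I a v)) j := by
    intro v j
    simp [c, Matrix.mulVec, dotProduct]
  refine ⟨fun u => ?_, fun v => ?_, fun hd => ?_⟩
  · have h1 : ∀ i, p i (I a (u + L a (ι u))) = (Mt a).mulVec (fun j => p j u) i := by
      intro i
      rw [hMp, hA, map_add, hIG]
      simp
    have h2 : ∀ j, c a j (u + L a (ι u)) = (Mt a).det * p j u := by
      intro j
      rw [hcv, funext h1, Matrix.mulVec_mulVec, Matrix.adjugate_mul]
      simp [Matrix.smul_mulVec]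
    simp only [N, _root_.sub_apply, _root_.smul_apply,
      _root_.sum_apply, ContinuousLinearMap.smulRight_apply, h2]
    rw [hA, map_add, hIG]
    simp [mul_smul, Finset.smul_sum]
  · have hN : N a v = (Mt a).det • I a v - ∑ j, c a j v • I a (L a (e j)) := by
      simp [N]
    have h1 : ∀ i, p i (N a v) = c a i v := by
      intro i
      have : (Mt a).mulVec (fun j => c a j v) i = (Mt a).det * p i (I a v) := by
        rw [funext (hcv v), Matrix.mulVec_mulVec, Matrix.mul_adjugate]
        simp [Matrix.smul_mulVec]
      rw [hMp] at this
      rw [hN]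
      simp only [map_sub, map_smul, map_sum, smul_eq_mul]
      rw [← this]; ring
    rw [hA]
    simp only [h1]
    rw [hN]
    simp [hGI]
  -- A kernel vector `x` of `Mt a` is recovered from the candidate `u` as the numbers `p i u`, so
  -- `u` is not zero.
  · obtain ⟨x, hx, hMx⟩ := Matrix.exists_mulVec_eq_zero_iff.2 hd
    have h1 : ∀ i, p i (-∑ j, x j • I a (L a (e j))) = x i := by
      intro i
      have := congrFun hMx i
      rw [hMp] at this
      simp only [map_neg, map_smul, map_sum, smul_eq_mul]
      exact (eq_neg_of_add_eq_zero_left this).symm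
    refine ⟨-∑ j, x j • I a (L a (e j)), fun h0 => hx (funext fun i => ?_), ?_⟩
    · rw [← h1 i, h0]; simp
    · rw [hA]
      simp only [h1]
      simp [hGI]

/-- Along an analytic family `1 + L a ∘ ι` that is injective somewhere, non-injectivity is a
discrete phenomenon. -/
theorem eventually_injective {ι : E →L[ℂ] H} (hι : FiniteRankApproximable ι)
    {L : ℂ → H →L[ℂ] E} (hL : ∀ a, AnalyticAt ℂ L a) {a₁ : ℂ}
    (h₁ : ∀ u, u + L a₁ (ι u) = 0 → u = 0) (a : ℂ) :
    ∀ᶠ y in 𝓝[≠] a, ∀ u, u + L y (ι u) = 0 → u = 0 := by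
  have key : ∀ a, (∀ᶠ y in 𝓝 a, ¬ ∀ u, u + L y (ι u) = 0 → u = 0) ∨
      ∀ᶠ y in 𝓝[≠] a, ∀ u, u + L y (ι u) = 0 → u = 0 := by
    intro a
    obtain ⟨d, N, hd, -, h⟩ := exists_analytic_cramer hι (hL a)
    rcases hd.eventually_eq_zero_or_eventually_ne_zero with h0 | h0
    · left
      filter_upwards [h, h0] with y hy hy0 hinj
      obtain ⟨u, hu, hu'⟩ := hy.2.2 hy0
      exact hu (hinj u hu')
    · right
      filter_upwards [h.filter_mono nhdsWithin_le_nhds, h0] with y hy hy0 u hu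
      have := hy.1 u
      rw [hu, map_zero] at this
      exact (smul_eq_zero.1 this).resolve_left hy0
  -- `Z` collects the exponents near which injectivity always fails. It is open and closed and
  -- misses `a₁`, so it is empty.
  let Z : Set ℂ := {a | ∀ᶠ y in 𝓝 a, ¬ ∀ u, u + L y (ι u) = 0 → u = 0}
  have hZo : IsOpen Z := isOpen_iff_mem_nhds.2 fun a ha => eventually_eventually_nhds.2 ha
  have hZc : IsClosed Z := by
    refine ⟨isOpen_iff_mem_nhds.2 fun a ha => ?_⟩
    have h' := (key a).resolve_left ha
    rw [eventually_nhdsWithin_iff, ← eventually_eventually_nhds] at h'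
    filter_upwards [h'] with y hy hyZ
    -- If `y` were in `Z`, points near `y` would be non-injective, while near `a` only `a` itself
    -- may be; then `{a}` would be a neighbourhood of `y`, and `ℂ` has no isolated points.
    have h2 : ∀ᶠ x in 𝓝 y, x = a := by
      filter_upwards [hy, hyZ] with x hx hx'
      by_contra hne
      exact hx' (hx hne)
    have h3 : {a} ∈ 𝓝 y := h2
    have hya : y = a := h2.self_of_nhds
    subst hya
    exact not_isOpen_singleton (y : ℂ) (isOpen_singleton_iff_nhds_eq_pure y |>.2
      (le_antisymm (by simpa using h3) (pure_le_nhds y)))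
  have hZ : Z = ∅ := by
    rcases isClopen_iff.1 ⟨hZc, hZo⟩ with h | h
    · exact h
    · have : a₁ ∈ Z := h ▸ Set.mem_univ _
      have h2 : ∀ᶠ y in 𝓝 a₁, ¬ ∀ u, u + L y (ι u) = 0 → u = 0 := this
      exact absurd h₁ h2.self_of_nhds
  exact (key a).resolve_left fun h => by
    have : a ∈ Z := h
    simp [hZ] at this

end Fredholm

/-! ### Test functions and the calculus of weak derivatives -/

/-- Complex-valued test functions on `U`. -/
structure IsTest (U : Set (ℝ × ℝ)) (φ : ℝ × ℝ → ℂ) : Prop where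
  smooth : ContDiff ℝ ∞ φ
  compact : HasCompactSupport φ
  support : tsupport φ ⊆ U

namespace IsTest

variable {U Q : Set (ℝ × ℝ)} {φ : ℝ × ℝ → ℂ}

theorem mono (h : IsTest U φ) (hU : U ⊆ Q) : IsTest Q φ := ⟨h.1, h.2, h.3.trans hU⟩

theorem eq_zero (h : IsTest U φ) {x : ℝ × ℝ} (hx : x ∉ U) : φ x = 0 :=
  image_eq_zero_of_notMem_tsupport fun h' => hx (h.3 h')

theorem fderiv_apply (h : IsTest U φ) (e : ℝ × ℝ) : IsTest U fun x => fderiv ℝ φ x e :=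
  ⟨(h.1.fderiv_right (m := ∞) (by simp)).clm_apply contDiff_const, h.2.fderiv_apply ℝ e,
    (tsupport_fderiv_apply_subset ℝ e).trans h.3⟩

theorem ofReal {φ : ℝ × ℝ → ℝ} (h1 : ContDiff ℝ ∞ φ) (h2 : HasCompactSupport φ)
    (h3 : tsupport φ ⊆ U) : IsTest U fun x => (φ x : ℂ) := by
  refine ⟨Complex.ofRealCLM.contDiff.comp h1, h2.comp_left Complex.ofReal_zero, ?_⟩
  exact (closure_mono (Function.support_comp_subset Complex.ofReal_zero φ)).trans h3

theorem mul_left (h : IsTest U φ) {c : ℝ × ℝ → ℂ} (hc : ContDiff ℝ ∞ c) :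
    IsTest U fun x => c x * φ x :=
  ⟨hc.mul h.1, h.2.mul_left, (tsupport_mul_subset_right).trans h.3⟩

theorem translate (h : IsTest U φ) (s : ℝ × ℝ) (hs : ∀ x ∈ tsupport φ, x + s ∈ Q) :
    IsTest Q fun x => φ (x - s) := by
  refine ⟨h.1.comp (contDiff_id.sub contDiff_const),
    h.2.comp_homeomorph (Homeomorph.subRight s), ?_⟩
  have : tsupport (fun x => φ (x - s)) = (Homeomorph.subRight s) ⁻¹' tsupport φ :=
    (tsupport_comp_eq_preimage φ (Homeomorph.subRight s))
  rw [this]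
  intro x hx
  simpa using hs _ hx

end IsTest

theorem fderiv_ofReal {φ : ℝ × ℝ → ℝ} (h : ContDiff ℝ ∞ φ) (x e : ℝ × ℝ) :
    fderiv ℝ (fun x => (φ x : ℂ)) x e = (fderiv ℝ φ x e : ℂ) := by
  have := (Complex.ofRealCLM.hasFDerivAt.comp x
    ((h.differentiable (by simp)) x).hasFDerivAt).fderiv
  have h2 := congrArg (fun T => T e) this
  simpa [Function.comp_def] using h2

section

variable {U Q : Set (ℝ × ℝ)} {e e' : ℝ × ℝ} {u g g' : ℝ × ℝ → ℂ}

theorem integrable_test_mul (hu : LocallyIntegrableOn u U)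
    {φ : ℝ × ℝ → ℂ} (hφ : IsTest U φ) :
    Integrable (fun x => φ x * u x) (volume.restrict U) := by
  have h1 : IntegrableOn u (tsupport φ) := hu.integrableOn_compact_subset hφ.3 hφ.2
  have h2 : IntegrableOn (fun x => φ x * u x) (tsupport φ) :=
    h1.continuousOn_mul hφ.1.continuous.continuousOn hφ.2
  refine Integrable.mono_measure ?_ Measure.restrict_le_self
  rw [integrableOn_iff_integrable_of_support_subset] at h2
  · exact h2
  · intro x hx
    refine subset_tsupport _ fun h => hx ?_
    simp [h]

/-- A weak derivative may be tested against complex-valued functions. -/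
theorem IsWeakDeriv.test (h : IsWeakDeriv U e u g) (hu : LocallyIntegrableOn u U)
    (hg : LocallyIntegrableOn g U) {φ : ℝ × ℝ → ℂ} (hφ : IsTest U φ) :
    ∫ x in U, fderiv ℝ φ x e * u x = -∫ x in U, φ x * g x := by
  have hd : ∀ x, DifferentiableAt ℝ φ x := fun x => hφ.1.differentiable (by simp) x
  have part : ∀ T : ℂ →L[ℝ] ℝ, IsTest U (fun x => ((T (φ x) : ℝ) : ℂ)) ∧
      ∫ x in U, ((T (fderiv ℝ φ x e) : ℝ) : ℂ) * u x = -∫ x in U, ((T (φ x) : ℝ) : ℂ) * g x := by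
    intro T
    have h1 : ContDiff ℝ ∞ fun x => T (φ x) := T.contDiff.comp hφ.1
    have h2 : HasCompactSupport fun x => T (φ x) := hφ.2.comp_left (map_zero T)
    have h3 : tsupport (fun x => T (φ x)) ⊆ U :=
      (closure_mono (Function.support_comp_subset (map_zero T) φ)).trans hφ.3
    refine ⟨IsTest.ofReal h1 h2 h3, ?_⟩
    have := h _ h1 h2 h3
    have hf : ∀ x, fderiv ℝ (fun x => T (φ x)) x e = T (fderiv ℝ φ x e) := fun x => by
      have := (T.hasFDerivAt.comp x (hd x).hasFDerivAt).fderiv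
      exact congrArg (fun S => S e) this
    simpa only [hf, Complex.real_smul] using this
  have hdφ := hφ.fderiv_apply e
  have partd : ∀ T : ℂ →L[ℝ] ℝ, IsTest U (fun x => ((T (fderiv ℝ φ x e) : ℝ) : ℂ)) := fun T =>
    IsTest.ofReal (T.contDiff.comp hdφ.1) (hdφ.2.comp_left (map_zero T))
      ((closure_mono (Function.support_comp_subset (map_zero T) _)).trans hdφ.3)
  have split : ∀ (ψ : ℝ × ℝ → ℂ) (v : ℝ × ℝ → ℂ), LocallyIntegrableOn v U →
      IsTest U (fun x => ((Complex.reCLM (ψ x) : ℝ) : ℂ)) →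
      IsTest U (fun x => ((Complex.imCLM (ψ x) : ℝ) : ℂ)) →
      ∫ x in U, ψ x * v x = (∫ x in U, ((Complex.reCLM (ψ x) : ℝ) : ℂ) * v x) +
        Complex.I * ∫ x in U, ((Complex.imCLM (ψ x) : ℝ) : ℂ) * v x := by
    intro ψ v hv hr hi
    rw [← integral_const_mul, ← integral_add (integrable_test_mul hv hr)
      ((integrable_test_mul hv hi).const_mul _)]
    refine integral_congr_ae (ae_of_all _ fun x => ?_)
    have := Complex.re_add_im (ψ x)
    simp only [Complex.reCLM_apply, Complex.imCLM_apply]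
    linear_combination (-(v x)) * this
  rw [split _ u hu (partd _) (partd _), split _ g hg (part _).1 (part _).1, (part _).2, (part _).2]
  ring

theorem IsTest.setIntegral_eq {φ : ℝ × ℝ → ℂ} (hφ : IsTest U φ) (v : ℝ × ℝ → ℂ) :
    ∫ x in U, φ x * v x = ∫ x, φ x * v x :=
  setIntegral_eq_integral_of_forall_compl_eq_zero fun x hx => by simp [hφ.eq_zero hx]

theorem isWeakDeriv_of_test
    (h : ∀ φ, IsTest U φ → ∫ x in U, fderiv ℝ φ x e * u x = -∫ x in U, φ x * g x) :
    IsWeakDeriv U e u g := by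
  intro φ h1 h2 h3
  have := h _ (IsTest.ofReal h1 h2 h3)
  simpa only [fderiv_ofReal h1, Complex.real_smul] using this

theorem IsWeakDeriv.mono (h : IsWeakDeriv U e u g) (hQ : Q ⊆ U) : IsWeakDeriv Q e u g := by
  intro φ h1 h2 h3
  have ht := IsTest.ofReal h1 h2 h3
  have h4 := h φ h1 h2 (h3.trans hQ)
  simp only [Complex.real_smul, ← fderiv_ofReal h1] at h4 ⊢
  rwa [(ht.mono hQ).setIntegral_eq, ((ht.mono hQ).fderiv_apply e).setIntegral_eq,
    ← ht.setIntegral_eq, ← (ht.fderiv_apply e).setIntegral_eq] at h4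

theorem IsWeakDeriv.direction_add (h : IsWeakDeriv U e u g) (h' : IsWeakDeriv U e' u g')
    (hu : LocallyIntegrableOn u U) (hg : LocallyIntegrableOn g U)
    (hg' : LocallyIntegrableOn g' U) (s t : ℝ) :
    IsWeakDeriv U (s • e + t • e') u fun x => s * g x + t * g' x := by
  refine isWeakDeriv_of_test fun φ hφ => ?_
  have h1 := h.test hu hg hφ
  have h2 := h'.test hu hg' hφ
  simp only [map_add, map_smul, add_mul, mul_add, Complex.real_smul, mul_assoc]
  simp only [mul_left_comm (φ _)]
  rw [integral_add ((integrable_test_mul hu (hφ.fderiv_apply e)).const_mul _)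
      ((integrable_test_mul hu (hφ.fderiv_apply e')).const_mul _),
    integral_add ((integrable_test_mul hg hφ).const_mul _)
      ((integrable_test_mul hg' hφ).const_mul _), integral_const_mul, integral_const_mul,
      integral_const_mul, integral_const_mul, h1, h2]
  ring

/-- The weight `exp (a x₁)` that changes the Floquet multiplier. -/
noncomputable def weight (a : ℂ) (x : ℝ × ℝ) : ℂ := Complex.exp (a * x.1)

theorem contDiff_weight (a : ℂ) : ContDiff ℝ ∞ (weight a) :=
  (contDiff_const.mul (Complex.ofRealCLM.contDiff.comp contDiff_fst)).cexp

theorem fderiv_weight (a : ℂ) (x e : ℝ × ℝ) :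
    fderiv ℝ (weight a) x e = a * e.1 * weight a x := by
  have h1 : HasFDerivAt (fun x : ℝ × ℝ => (x.1 : ℂ))
      (Complex.ofRealCLM.comp (ContinuousLinearMap.fst ℝ ℝ ℝ)) x :=
    (Complex.ofRealCLM.comp (ContinuousLinearMap.fst ℝ ℝ ℝ)).hasFDerivAt
  have h2 := ((h1.const_mul a).cexp).fderiv
  have h3 := congrArg (fun T => T e) h2
  refine h3.trans ?_
  simp [weight]
  ring

/-- The smooth weight is moved onto the test function, and the Leibniz rule there produces the extra
term with `a * e.1`. -/
theorem IsWeakDeriv.weight_mul (h : IsWeakDeriv U e u g)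
    (hu : LocallyIntegrableOn u U) (hg : LocallyIntegrableOn g U) (a : ℂ) :
    IsWeakDeriv U e (fun x => weight a x * u x)
      fun x => weight a x * (g x + a * e.1 * u x) := by
  refine isWeakDeriv_of_test fun φ hφ => ?_
  have hc := contDiff_weight a
  have hcφ := hφ.mul_left hc
  have h1 := h.test hu hg hcφ
  have hf : ∀ x, fderiv ℝ (fun x => weight a x * φ x) x e =
      weight a x * fderiv ℝ φ x e + a * e.1 * (weight a x * φ x) := fun x => by
    have := ((hc.differentiable (by simp) x).hasFDerivAt.mul
      (hφ.1.differentiable (by simp) x).hasFDerivAt).fderiv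
    have h2 := congrArg (fun T => T e) this
    refine h2.trans ?_
    simp [fderiv_weight]
    ring
  simp only [hf, add_mul, mul_assoc (a * (e.1 : ℂ))] at h1
  rw [integral_add (integrable_test_mul hu ((hφ.fderiv_apply e).mul_left hc))
    ((integrable_test_mul hu hcφ).const_mul _), integral_const_mul] at h1
  have h3 : ∫ x in U, φ x * (weight a x * (g x + a * e.1 * u x)) =
      (∫ x in U, weight a x * φ x * g x) + a * e.1 * ∫ x in U, weight a x * φ x * u x := by
    rw [← integral_const_mul, ← integral_add (integrable_test_mul hg hcφ)
      ((integrable_test_mul hu hcφ).const_mul _)]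
    refine integral_congr_ae (ae_of_all _ fun x => ?_)
    ring
  have h4 : ∫ x in U, fderiv ℝ φ x e * (weight a x * u x) =
      ∫ x in U, weight a x * fderiv ℝ φ x e * u x :=
    integral_congr_ae (ae_of_all _ fun x => by ring)
  rw [h3, h4]
  linear_combination h1

theorem IsWeakDeriv.conj (h : IsWeakDeriv U e u g) :
    IsWeakDeriv U e (fun x => star (u x)) fun x => star (g x) := by
  intro φ h1 h2 h3
  have := congrArg (starRingEnd ℂ) (h φ h1 h2 h3)
  rw [map_neg, ← integral_conj, ← integral_conj] at this
  simpa using this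

theorem ae_eq_of_test (hU : IsOpen U) (hu : LocallyIntegrableOn u U)
    (hg : LocallyIntegrableOn g U)
    (h : ∀ φ, IsTest U φ → ∫ x in U, φ x * u x = ∫ x in U, φ x * g x) :
    ∀ᵐ x, x ∈ U → u x = g x := by
  have := hU.ae_eq_zero_of_integral_contDiff_smul_eq_zero (μ := volume) (hu.sub hg) ?_
  · filter_upwards [this] with x hx hxU
    exact sub_eq_zero.1 (hx hxU)
  · intro φ h1 h2 h3
    have ht := IsTest.ofReal h1 h2 h3
    have h4 := h _ ht
    rw [← sub_eq_zero, ← integral_sub (integrable_test_mul hu ht) (integrable_test_mul hg ht)] at h4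
    rw [← setIntegral_eq_integral_of_forall_compl_eq_zero (s := U), ← h4]
    · refine integral_congr_ae (ae_of_all _ fun x => ?_)
      simp [Complex.real_smul, mul_sub]
    · intro x hx
      have := ht.eq_zero hx
      simp only [Complex.ofReal_eq_zero] at this
      simp [this]

theorem IsWeakDeriv.unique (h : IsWeakDeriv U e u g) (h' : IsWeakDeriv U e u g') (hU : IsOpen U)
    (hu : LocallyIntegrableOn u U) (hg : LocallyIntegrableOn g U)
    (hg' : LocallyIntegrableOn g' U) : ∀ᵐ x, x ∈ U → g x = g' x := by
  refine ae_eq_of_test hU hg hg' fun φ hφ => ?_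
  rw [← neg_inj, ← h.test hu hg hφ, ← h'.test hu hg' hφ]

theorem MemLp.locallyIntegrableOn (hu : MemLp u 2 (volume.restrict U)) :
    LocallyIntegrableOn u U := by
  have := hu.locallyIntegrable (by norm_num)
  exact locallyIntegrableOn_of_locallyIntegrable_restrict this

/-! ### Duality for `L²` norms and the translation estimate -/

/-- The test functions on `Ω`, as a subspace of `L²(Ω)`. -/
def testSubmodule (Ω : Set (ℝ × ℝ)) : Submodule ℂ (Lp ℂ 2 (volume.restrict Ω)) where
  carrier := {f | ∃ φ, IsTest Ω φ ∧ f =ᵐ[volume.restrict Ω] φ}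
  zero_mem' := by
    refine ⟨0, ⟨contDiff_const, HasCompactSupport.zero, by simp [tsupport]⟩, Lp.coeFn_zero _ _ _⟩
  add_mem' := by
    rintro f f' ⟨φ, hφ, h⟩ ⟨φ', hφ', h'⟩
    refine ⟨φ + φ', ⟨hφ.1.add hφ'.1, hφ.2.add hφ'.2, ?_⟩, (Lp.coeFn_add f f').trans (h.add h')⟩
    exact (tsupport_add φ φ').trans (Set.union_subset hφ.3 hφ'.3)
  smul_mem' := by
    rintro c f ⟨φ, hφ, h⟩
    exact ⟨fun x => c * φ x, hφ.mul_left contDiff_const,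
      (Lp.coeFn_smul c f).trans (h.mono fun x hx => by simp [hx])⟩

theorem IsTest.memLp {φ : ℝ × ℝ → ℂ} (hφ : IsTest U φ) (p : ℝ≥0∞) (Ω : Set (ℝ × ℝ)) :
    MemLp φ p (volume.restrict Ω) :=
  hφ.1.continuous.memLp_of_hasCompactSupport hφ.2

/-- A vector orthogonal to all test functions vanishes by the fundamental lemma of the calculus of
variations. -/
theorem testSubmodule_dense {Ω : Set (ℝ × ℝ)} (hΩ : IsOpen Ω) :
    Dense (testSubmodule Ω : Set (Lp ℂ 2 (volume.restrict Ω))) := by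
  rw [Submodule.dense_iff_topologicalClosure_eq_top, Submodule.topologicalClosure_eq_top_iff,
    Submodule.eq_bot_iff]
  intro v hv
  rw [Submodule.mem_orthogonal'] at hv
  have h0 : ∀ᵐ x, x ∈ Ω → star (v x) = (0 : ℝ × ℝ → ℂ) x := by
    refine ae_eq_of_test hΩ (MemLp.locallyIntegrableOn (Lp.memLp v).star)
      (MemLp.locallyIntegrableOn MemLp.zero) fun φ hφ => ?_
    have h1 := hv _ ⟨φ, hφ, (hφ.memLp 2 Ω).coeFn_toLp⟩
    rw [L2.inner_def] at h1
    simp only [Pi.zero_apply, mul_zero, integral_zero]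
    rw [← h1]
    refine integral_congr_ae ((hφ.memLp 2 Ω).coeFn_toLp.mono fun x hx => ?_)
    simp [hx]
  refine Lp.eq_zero_iff_ae_eq_zero.2 ?_
  filter_upwards [(ae_restrict_iff' hΩ.measurableSet).2 h0] with x hx
  simpa using hx

theorem norm_integral_mul_le {α : Type*} {m : MeasurableSpace α} {μ : Measure α} {f g : α → ℂ}
    (hf : MemLp f 2 μ) (hg : MemLp g 2 μ) :
    ‖∫ x, f x * g x ∂μ‖ ≤ (eLpNorm f 2 μ).toReal * (eLpNorm g 2 μ).toReal := by
  have h1 : ∫ x, f x * g x ∂μ = inner ℂ (hf.star.toLp _) (hg.toLp g) := by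
    rw [L2.inner_def]
    refine integral_congr_ae ?_
    filter_upwards [hf.star.coeFn_toLp, hg.coeFn_toLp] with x hx hx'
    simp [hx, hx', mul_comm]
  rw [h1]
  refine (norm_inner_le_norm _ _).trans_eq ?_
  rw [Lp.norm_toLp, Lp.norm_toLp, eLpNorm_star]

/-- The `L²` norm is determined by testing against smooth functions. -/
theorem norm_le_of_test {Ω : Set (ℝ × ℝ)} (hΩ : IsOpen Ω) (v : Lp ℂ 2 (volume.restrict Ω)) {C : ℝ}
    (hC : 0 ≤ C) (h : ∀ φ (hφ : IsTest Ω φ), ‖∫ x in Ω, φ x * v x‖ ≤ C * ‖(hφ.memLp 2 Ω).toLp φ‖) :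
    ‖v‖ ≤ C := by
  -- The bilinear integral of `φ * v` is the inner product with `star v`. The bound is a closed
  -- condition, so density extends it to all `f`, and then `f = star v` gives the norm.
  have key : ∀ f : Lp ℂ 2 (volume.restrict Ω), ‖inner ℂ (star v) f‖ ≤ C * ‖f‖ := by
    intro f
    have hcl : IsClosed {f : Lp ℂ 2 (volume.restrict Ω) | ‖inner ℂ (star v) f‖ ≤ C * ‖f‖} :=
      isClosed_le (by fun_prop) (by fun_prop)
    refine hcl.closure_subset_iff.2 ?_ (testSubmodule_dense hΩ f)
    rintro f ⟨φ, hφ, hf⟩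
    have hf' : f = (hφ.memLp 2 Ω).toLp φ :=
      Lp.ext (hf.trans (hφ.memLp 2 Ω).coeFn_toLp.symm)
    have h1 := h φ hφ
    rw [← hf'] at h1
    refine le_of_eq_of_le (congrArg norm ?_) h1
    rw [L2.inner_def]
    refine integral_congr_ae ?_
    filter_upwards [hf, Lp.coeFn_star v] with x hx hx'
    simp [hx, hx']
  have h2 := key (star v)
  rw [inner_self_eq_norm_sq_to_K] at h2
  have h3 : ‖star v‖ = ‖v‖ := by
    rw [Lp.norm_def, Lp.norm_def]
    congr 1
    refine eLpNorm_congr_norm_ae ((Lp.coeFn_star v).mono fun x hx => ?_)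
    simp [hx]
  rw [h3] at h2
  simp only [norm_pow, RCLike.norm_ofReal, abs_norm] at h2
  rcases eq_or_lt_of_le (norm_nonneg v) with h4 | h4
  · rwa [← h4]
  · nlinarith

/-- The translation acts on the smooth factor, so differentiating under the integral only needs `u`
to be integrable. -/
theorem IsTest.hasDerivAt_integral_translate {φ : ℝ × ℝ → ℂ} (hφ : IsTest U φ)
    (hu1 : Integrable u (volume.restrict Q)) (σ : ℝ × ℝ) (r : ℝ) :
    HasDerivAt (fun r : ℝ => ∫ x in Q, φ (x - r • σ) * u x)
      (∫ x in Q, -(fderiv ℝ φ (x - r • σ) σ) * u x) r := by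
  have hφd : ∀ x, HasFDerivAt φ (fderiv ℝ φ x) x := fun x =>
    (hφ.1.differentiable (by simp) x).hasFDerivAt
  obtain ⟨B, hB⟩ := (hφ.fderiv_apply σ).1.continuous.bounded_above_of_compact_support
    (hφ.fderiv_apply σ).2
  refine (hasDerivAt_integral_of_dominated_loc_of_deriv_le (bound := fun x => B * ‖u x‖)
    (F := fun r x => φ (x - r • σ) * u x)
    (F' := fun r x => -(fderiv ℝ φ (x - r • σ) σ) * u x) (s := Set.univ)
    univ_mem ?_ ?_ ?_ ?_ ?_ ?_).2
  · refine Eventually.of_forall fun r => ?_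
    exact ((hφ.1.continuous.comp (continuous_id.sub continuous_const)).aestronglyMeasurable).mul
      hu1.1
  · obtain ⟨B', hB'⟩ := hφ.1.continuous.bounded_above_of_compact_support hφ.2
    exact hu1.bdd_mul (c := B')
      (hφ.1.continuous.comp (continuous_id.sub continuous_const)).aestronglyMeasurable
      (ae_of_all _ fun x => hB' _)
  · exact ((((hφ.fderiv_apply σ).1.continuous.comp
      (continuous_id.sub continuous_const)).neg).aestronglyMeasurable).mul hu1.1
  · refine ae_of_all _ fun x s _ => ?_
    rw [norm_mul, norm_neg]
    gcongr
    exact hB _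
  · exact hu1.norm.const_mul _
  · refine ae_of_all _ fun x s _ => ?_
    have h1 : HasDerivAt (fun s : ℝ => x - s • σ) (-σ) s := by
      simpa using ((hasDerivAt_id s).smul_const σ).const_sub x
    have := (hφd (x - s • σ)).comp_hasDerivAt s h1
    simpa using this.mul_const (u x)

/-- Translation estimate for functions with a weak derivative. -/
theorem IsWeakDeriv.eLpNorm_translate_sub_le {σ : ℝ × ℝ} (h : IsWeakDeriv Q σ u g)
    (hQ : IsOpen Q) (hconv : Convex ℝ Q) (hvol : volume Q ≠ ⊤)
    (hu : MemLp u 2 (volume.restrict Q)) (hg : MemLp g 2 (volume.restrict Q)) :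
    eLpNorm (fun x => u (x + σ) - u x) 2 (volume.restrict (Q ∩ {x | x + σ ∈ Q})) ≤
      eLpNorm g 2 (volume.restrict Q) := by
  set Ω := Q ∩ {x | x + σ ∈ Q} with hΩdef
  have hΩ : IsOpen Ω := hQ.inter (hQ.preimage (continuous_id.add continuous_const))
  have hmp : MeasurePreserving (fun x : ℝ × ℝ => x + σ) (volume.restrict ((fun x => x + σ) ⁻¹' Q))
      (volume.restrict Q) :=
    (measurePreserving_add_right volume σ).restrict_preimage hQ.measurableSet
  have hut : MemLp (fun x => u (x + σ)) 2 (volume.restrict Ω) :=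
    (hu.comp_measurePreserving hmp).mono_measure (Measure.restrict_mono Set.inter_subset_right le_rfl)
  have hv : MemLp (fun x => u (x + σ) - u x) 2 (volume.restrict Ω) :=
    hut.sub (hu.mono_measure (Measure.restrict_mono Set.inter_subset_left le_rfl))
  have : IsFiniteMeasure (volume.restrict Q) := ⟨by simpa using hvol.lt_top⟩
  have hu1 : Integrable u (volume.restrict Q) := hu.integrable (by norm_num)
  have hul : LocallyIntegrableOn u Q := MemLp.locallyIntegrableOn hu
  have hgl : LocallyIntegrableOn g Q := MemLp.locallyIntegrableOn hg
  have key : ‖hv.toLp _‖ ≤ (eLpNorm g 2 (volume.restrict Q)).toReal := by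
    refine norm_le_of_test hΩ _ ENNReal.toReal_nonneg fun φ hφ => ?_
    -- Points of `Ω` have both `x` and `x + σ` in the convex set `Q`, so the support stays in `Q`
    -- all along the way.
    have ht : ∀ r ∈ Set.Icc (0 : ℝ) 1, IsTest Q fun x => φ (x - r • σ) := fun r hr =>
      hφ.translate _ fun x hx => by
        have hx' := hφ.3 hx
        have := hconv hx'.1 hx'.2 (sub_nonneg.2 hr.2) hr.1 (by ring)
        convert this using 1
        module
    -- `F 1 - F 0` is the translation difference tested against `φ`. By the weak derivative, `F'` is
    -- the integral of `φ (x - r • σ) * g x`; Cauchy–Schwarz and the mean value inequality then give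
    -- the bound.
    let F : ℝ → ℂ := fun r => ∫ x in Q, φ (x - r • σ) * u x
    have hFd : ∀ r, HasDerivAt F (∫ x in Q, -(fderiv ℝ φ (x - r • σ) σ) * u x) r :=
      hφ.hasDerivAt_integral_translate hu1 σ
    have hFb : ∀ r ∈ Set.Ico (0 : ℝ) 1, ‖∫ x in Q, -(fderiv ℝ φ (x - r • σ) σ) * u x‖ ≤
        (eLpNorm g 2 (volume.restrict Q)).toReal * ‖(hφ.memLp 2 Ω).toLp φ‖ := by
      intro r hr
      have htr := ht r ⟨hr.1, hr.2.le⟩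
      have hfd : ∀ x, fderiv ℝ (fun x => φ (x - r • σ)) x σ = fderiv ℝ φ (x - r • σ) σ := fun x => by
        rw [fderiv_comp_sub]
      have h1 := h.test hul hgl htr
      simp only [hfd] at h1
      simp only [neg_mul]
      rw [integral_neg, h1, neg_neg, mul_comm]
      refine (norm_integral_mul_le (htr.memLp 2 Q) hg).trans ?_
      gcongr
      rw [Lp.norm_toLp]
      refine ENNReal.toReal_mono (hφ.memLp 2 Ω).2.ne ?_
      calc eLpNorm (fun x => φ (x - r • σ)) 2 (volume.restrict Q)
          ≤ eLpNorm (fun x => φ (x - r • σ)) 2 volume :=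
            eLpNorm_mono_measure _ Measure.restrict_le_self
        _ = eLpNorm φ 2 volume := eLpNorm_comp_measurePreserving
            (g := φ) hφ.1.continuous.aestronglyMeasurable (measurePreserving_sub_right volume (r • σ))
        _ = eLpNorm φ 2 (volume.restrict Ω) := by
            rw [← eLpNorm_indicator_eq_eLpNorm_restrict hΩ.measurableSet]
            congr 1
            refine (Set.indicator_eq_self.2 fun x hx => ?_).symm
            by_contra h
            exact hx (hφ.eq_zero h)
    have := norm_image_sub_le_of_norm_deriv_le_segment_01'
      (fun r _ => (hFd r).hasDerivWithinAt) hFb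
    refine le_of_eq_of_le (congrArg norm ?_) this
    have h1 : F 1 = ∫ x in Ω, φ x * u (x + σ) := by
      have h2 := (ht 1 (by simp)).setIntegral_eq u
      rw [one_smul] at h2
      rw [hφ.setIntegral_eq, ← integral_sub_right_eq_self _ σ]
      simpa [F] using h2
    have h0 : F 0 = ∫ x in Ω, φ x * u x := by
      have h2 := (ht 0 (by simp)).setIntegral_eq u
      rw [hφ.setIntegral_eq]
      simpa [F] using h2
    rw [h1, h0, ← integral_sub]
    · refine integral_congr_ae (hv.coeFn_toLp.mono fun x hx => ?_)
      simp only [hx]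
      ring
    · exact integrable_test_mul (MemLp.locallyIntegrableOn hut) hφ
    · exact integrable_test_mul (hul.mono_set Set.inter_subset_left) hφ
  rw [Lp.norm_toLp] at key
  exact (ENNReal.toReal_le_toReal hv.2.ne hg.2.ne).1 key

end

/-! ### Poincaré's inequality on squares and Rellich's theorem -/

theorem eLpNorm_two_sq {α F : Type*} {m : MeasurableSpace α} {μ : Measure α}
    [NormedAddCommGroup F] (f : α → F) : eLpNorm f 2 μ ^ 2 = ∫⁻ x, ‖f x‖ₑ ^ 2 ∂μ := by
  have := eLpNorm_nnreal_pow_eq_lintegral (f := f) (μ := μ) (p := 2) (by norm_num)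
  simpa using this

theorem ofReal_norm_sq_eq_lintegral {α F : Type*} {m : MeasurableSpace α} {μ : Measure α}
    [NormedAddCommGroup F] (f : Lp F 2 μ) :
    ENNReal.ofReal (‖f‖ ^ 2) = ∫⁻ x, ‖f x‖ₑ ^ 2 ∂μ := by
  rw [← eLpNorm_two_sq, ENNReal.ofReal_pow (norm_nonneg _), ofReal_norm, Lp.enorm_def]

/-- The Poincaré inequality on a square, with a value of the function in place of its mean. -/
theorem exists_lintegral_sub_sq_le {a b h : ℝ} (hh : 0 < h) {u g₁ g₂ : ℝ × ℝ → ℂ}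
    (hum : Measurable u)
    (h₁ : IsWeakDeriv (Set.Ioo a (a + h) ×ˢ Set.Ioo b (b + h)) (1, 0) u g₁)
    (h₂ : IsWeakDeriv (Set.Ioo a (a + h) ×ˢ Set.Ioo b (b + h)) (0, 1) u g₂)
    (hu : MemLp u 2 (volume.restrict (Set.Ioo a (a + h) ×ˢ Set.Ioo b (b + h))))
    (hg₁ : MemLp g₁ 2 (volume.restrict (Set.Ioo a (a + h) ×ˢ Set.Ioo b (b + h))))
    (hg₂ : MemLp g₂ 2 (volume.restrict (Set.Ioo a (a + h) ×ˢ Set.Ioo b (b + h)))) :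
    ∃ c : ℂ, ∫⁻ x in Set.Ioo a (a + h) ×ˢ Set.Ioo b (b + h), ‖u x - c‖ₑ ^ 2 ≤
      ENNReal.ofReal (8 * h ^ 2) *
        ∫⁻ x in Set.Ioo a (a + h) ×ˢ Set.Ioo b (b + h), (‖g₁ x‖ₑ ^ 2 + ‖g₂ x‖ₑ ^ 2) := by
  set Q : Set (ℝ × ℝ) := Set.Ioo a (a + h) ×ˢ Set.Ioo b (b + h) with hQdef
  set G := ∫⁻ x in Q, (‖g₁ x‖ₑ ^ 2 + ‖g₂ x‖ₑ ^ 2) with hG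
  have hQ : IsOpen Q := isOpen_Ioo.prod isOpen_Ioo
  have hconv : Convex ℝ Q := (convex_Ioo _ _).prod (convex_Ioo _ _)
  have hvol : volume Q = ENNReal.ofReal (h ^ 2) := by
    rw [hQdef, Measure.volume_eq_prod, Measure.prod_prod, Real.volume_Ioo, Real.volume_Ioo,
      add_sub_cancel_left, add_sub_cancel_left, ← ENNReal.ofReal_mul hh.le, sq]
  -- `B` contains every difference of two points of `Q`, so only translations by `σ ∈ B` matter.
  let B : Set (ℝ × ℝ) := Set.Ioo (-h) h ×ˢ Set.Ioo (-h) h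
  have hB : volume B = ENNReal.ofReal (4 * h ^ 2) := by
    rw [Measure.volume_eq_prod, Measure.prod_prod, Real.volume_Ioo,
      ← ENNReal.ofReal_mul (by linarith)]
    congr 1; ring
  have hT : ∀ σ ∈ B, ∫⁻ x in Q ∩ {x | x + σ ∈ Q}, ‖u (x + σ) - u x‖ₑ ^ 2 ≤
      ENNReal.ofReal (2 * h ^ 2) * G := by
    rintro ⟨s, t⟩ ⟨hs, ht⟩
    have hd : IsWeakDeriv Q (s, t) u fun x => s * g₁ x + t * g₂ x := by
      have := h₁.direction_add h₂ (MemLp.locallyIntegrableOn hu) (MemLp.locallyIntegrableOn hg₁)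
        (MemLp.locallyIntegrableOn hg₂) s t
      simpa using this
    have h3 := hd.eLpNorm_translate_sub_le hQ hconv (by rw [hvol]; exact ENNReal.ofReal_ne_top) hu
      ((hg₁.const_mul (s : ℂ)).add (hg₂.const_mul (t : ℂ)))
    have h4 := pow_le_pow_left' h3 2
    rw [eLpNorm_two_sq, eLpNorm_two_sq] at h4
    refine h4.trans ?_
    rw [hG, ← lintegral_const_mul' _ _ ENNReal.ofReal_ne_top]
    refine lintegral_mono fun x => ?_
    simp only [← ofReal_norm]
    rw [← ENNReal.ofReal_pow (norm_nonneg _), ← ENNReal.ofReal_pow (norm_nonneg _),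
      ← ENNReal.ofReal_pow (norm_nonneg _), ← ENNReal.ofReal_add (by positivity) (by positivity),
      ← ENNReal.ofReal_mul (by positivity)]
    refine ENNReal.ofReal_le_ofReal ?_
    have h5 : ‖(s : ℂ) * g₁ x + t * g₂ x‖ ≤ h * ‖g₁ x‖ + h * ‖g₂ x‖ := by
      refine (norm_add_le _ _).trans ?_
      rw [norm_mul, norm_mul, Complex.norm_real, Complex.norm_real]
      gcongr
      · exact abs_le.2 ⟨hs.1.le, hs.2.le⟩
      · exact abs_le.2 ⟨ht.1.le, ht.2.le⟩
    calc ‖(s : ℂ) * g₁ x + t * g₂ x‖ ^ 2 ≤ (h * ‖g₁ x‖ + h * ‖g₂ x‖) ^ 2 := by gcongr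
      _ ≤ 2 * h ^ 2 * (‖g₁ x‖ ^ 2 + ‖g₂ x‖ ^ 2) := by
        nlinarith [mul_nonneg (sq_nonneg h) (sq_nonneg (‖g₁ x‖ - ‖g₂ x‖))]
  -- The double integral of `‖u p' - u p‖²` over `Q × Q` is computed by `p' = p + σ`. The
  -- translation estimate bounds it by `volume B = 4 h²` times `2 h² G`, that is `8 h⁴ G`.
  let F : ℝ × ℝ → ℝ × ℝ → ℝ≥0∞ := fun p p' =>
    (Q ×ˢ Q).indicator (fun z => ‖u z.2 - u z.1‖ₑ ^ 2) (p, p')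
  have hFm : Measurable (Function.uncurry F) :=
    (((hum.comp measurable_snd).sub (hum.comp measurable_fst)).enorm.pow_const 2).indicator
      (hQ.measurableSet.prod hQ.measurableSet)
  have htot : ∫⁻ p, ∫⁻ p', F p p' ≤ ENNReal.ofReal (8 * h ^ 4) * G := by
    calc ∫⁻ p, ∫⁻ p', F p p' = ∫⁻ p, ∫⁻ σ, F p (p + σ) :=
          lintegral_congr fun p => (lintegral_add_left_eq_self _ p).symm
      _ = ∫⁻ σ, ∫⁻ p, F p (p + σ) := by
          refine lintegral_lintegral_swap ?_
          exact (hFm.comp (measurable_fst.prodMk (measurable_fst.add measurable_snd))).aemeasurable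
      _ ≤ ∫⁻ σ, B.indicator (fun _ => ENNReal.ofReal (2 * h ^ 2) * G) σ := by
          refine lintegral_mono fun σ => ?_
          by_cases hσ : σ ∈ B
          · rw [Set.indicator_of_mem hσ]
            refine le_of_eq_of_le ?_ (hT σ hσ)
            have hΩ : MeasurableSet (Q ∩ {x | x + σ ∈ Q}) :=
              (hQ.inter (hQ.preimage (continuous_id.add continuous_const))).measurableSet
            rw [← lintegral_indicator hΩ]
            refine lintegral_congr fun p => ?_
            simp only [F, Set.indicator, Set.mem_prod, Set.mem_inter_iff, Set.mem_ofPred_eq]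
          · rw [Set.indicator_of_notMem hσ]
            refine (lintegral_eq_zero_of_ae_eq_zero (ae_of_all _ fun p => ?_)).le
            refine Set.indicator_of_notMem (fun hp => hσ ?_) _
            simp only [hQdef, Set.mem_prod, Set.mem_Ioo, Prod.fst_add, Prod.snd_add] at hp
            simp only [B, Set.mem_prod, Set.mem_Ioo]
            refine ⟨⟨?_, ?_⟩, ?_, ?_⟩ <;> linarith [hp.1.1.1]
      _ = ENNReal.ofReal (8 * h ^ 4) * G := by
          rw [lintegral_indicator (isOpen_Ioo.prod isOpen_Ioo).measurableSet, setLIntegral_const,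
            hB, mul_right_comm, ← ENNReal.ofReal_mul (by positivity)]
          congr 2; ring
  have hQ0 : volume Q ≠ 0 := by
    rw [hvol]; simpa using hh.ne'
  -- Some point `p` does no worse than the average over `Q`; dividing `8 h⁴` by the area `h²` leaves
  -- the constant `8 h²`, and `u p` serves as the constant `c`.
  obtain ⟨p, hp, hle⟩ := exists_le_setLAverage (μ := volume) (s := Q) (f := fun p => ∫⁻ p', F p p')
    hQ0 (by rw [hvol]; exact ENNReal.ofReal_ne_top)
    (hFm.lintegral_prod_right').aemeasurable
  refine ⟨u p, ?_⟩
  have h5 : ∫⁻ p', F p p' = ∫⁻ x in Q, ‖u x - u p‖ₑ ^ 2 := by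
    rw [← lintegral_indicator hQ.measurableSet]
    refine lintegral_congr fun x => ?_
    simp [F, Set.indicator, hp]
  rw [← h5]
  refine hle.trans ?_
  rw [setLAverage_eq, hvol]
  refine ENNReal.div_le_of_le_mul ?_
  refine (setLIntegral_le_lintegral _ _).trans (htot.trans_eq ?_)
  rw [mul_right_comm, ← ENNReal.ofReal_mul (by positivity)]
  congr 2; ring

/-- The open square number `(i, j)` in the subdivision of the cell into `n²` squares. -/
def square (n : ℕ) (p : Fin n × Fin n) : Set (ℝ × ℝ) :=
  Set.Ioo (-1 / 2 + p.1 * (n : ℝ)⁻¹) (-1 / 2 + p.1 * (n : ℝ)⁻¹ + (n : ℝ)⁻¹) ×ˢ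
    Set.Ioo (p.2 * (n : ℝ)⁻¹) (p.2 * (n : ℝ)⁻¹ + (n : ℝ)⁻¹)

theorem isOpen_cell : IsOpen cell := isOpen_Ioo.prod isOpen_Ioo

theorem isOpen_square (n : ℕ) (p : Fin n × Fin n) : IsOpen (square n p) :=
  isOpen_Ioo.prod isOpen_Ioo

theorem volume_cell : volume cell = 1 := by
  rw [cell, Measure.volume_eq_prod, Measure.prod_prod, Real.volume_Ioo, Real.volume_Ioo]
  norm_num

theorem square_subset_cell (n : ℕ) (p : Fin n × Fin n) : square n p ⊆ cell := by
  have hn : 0 < n := Fin.pos p.1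
  have key : ∀ i : Fin n, (i : ℝ) * (n : ℝ)⁻¹ + (n : ℝ)⁻¹ ≤ 1 := fun i => by
    have : (i : ℝ) + 1 ≤ n := by exact_mod_cast i.2
    have h2 : ((i : ℝ) + 1) * (n : ℝ)⁻¹ ≤ n * (n : ℝ)⁻¹ := by gcongr
    rw [mul_inv_cancel₀ (by positivity)] at h2
    linarith
  have key' : ∀ i : Fin n, 0 ≤ (i : ℝ) * (n : ℝ)⁻¹ := fun i => by positivity
  refine Set.prod_mono (Set.Ioo_subset_Ioo ?_ ?_) (Set.Ioo_subset_Ioo (key' _) (key _))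
  · linarith [key' p.1]
  · linarith [key p.1]

theorem pairwise_disjoint_square (n : ℕ) : Pairwise (Function.onFun Disjoint (square n)) := by
  have key : ∀ (c : ℝ) (i j : Fin n), i ≠ j →
      Disjoint (Set.Ioo (c + i * (n : ℝ)⁻¹) (c + i * (n : ℝ)⁻¹ + (n : ℝ)⁻¹))
        (Set.Ioo (c + j * (n : ℝ)⁻¹) (c + j * (n : ℝ)⁻¹ + (n : ℝ)⁻¹)) := by
    intro c i j hij
    have hij' : (i : ℤ) ≠ j := fun h => hij (Fin.ext (by exact_mod_cast h))
    have := Set.pairwise_disjoint_Ioo_add_zsmul c (n : ℝ)⁻¹ hij'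
    simp only [Function.onFun, zsmul_eq_mul, Int.cast_add, Int.cast_natCast, Int.cast_one, add_mul,
      one_mul, ← add_assoc] at this
    exact this
  rintro ⟨i, j⟩ ⟨i', j'⟩ hne
  simp only [Function.onFun, square, Set.disjoint_prod]
  by_cases hi : i = i'
  · right
    have hj : j ≠ j' := fun h => hne (by rw [hi, h])
    simpa using key 0 j j' hj
  · exact Or.inl (key _ i i' hi)

theorem iUnion_square_ae_eq {n : ℕ} (hn : 0 < n) : (⋃ p, square n p) =ᵐ[volume] cell := by
  refine ae_eq_of_subset_of_measure_ge (Set.iUnion_subset (square_subset_cell n)) ?_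
    (MeasurableSet.iUnion fun p => (isOpen_square n p).measurableSet).nullMeasurableSet
    (by rw [volume_cell]; exact ENNReal.one_ne_top)
  rw [measure_iUnion (pairwise_disjoint_square n) fun p => (isOpen_square n p).measurableSet,
    tsum_fintype, volume_cell]
  have hv : ∀ p, volume (square n p) = ENNReal.ofReal ((n : ℝ)⁻¹ * (n : ℝ)⁻¹) := fun p => by
    rw [square, Measure.volume_eq_prod, Measure.prod_prod, Real.volume_Ioo, Real.volume_Ioo,
      add_sub_cancel_left, add_sub_cancel_left, ← ENNReal.ofReal_mul (by positivity)]
  simp only [hv, Finset.sum_const, Finset.card_univ, Fintype.card_prod, Fintype.card_fin,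
    nsmul_eq_mul]
  rw [← ENNReal.ofReal_natCast, ← ENNReal.ofReal_mul (by positivity), ← ENNReal.ofReal_one]
  refine ENNReal.ofReal_le_ofReal (le_of_eq ?_)
  push_cast
  field_simp

theorem setLIntegral_cell_eq_sum {n : ℕ} (hn : 0 < n) (F : ℝ × ℝ → ℝ≥0∞) :
    ∫⁻ x in cell, F x = ∑ p, ∫⁻ x in square n p, F x := by
  rw [← setLIntegral_congr (iUnion_square_ae_eq hn), lintegral_iUnion
    (fun p => (isOpen_square n p).measurableSet) (pairwise_disjoint_square n), tsum_fintype]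

/-- Rellich's theorem for the cell. -/
theorem exists_finite_rank_approx {ε : ℝ} (hε : 0 < ε) :
    ∃ (m : ℕ) (e : Fin m → Lp ℂ 2 cellMeasure), ∀ w ∈ H1,
      ‖w 0 - ∑ j, inner ℂ (e j) (w 0) • e j‖ ≤ ε * ‖w‖ := by
  -- The error on squares of side `1 / n` will be `√8 / n` times the norm, and `√8 ≤ 3`.
  obtain ⟨n, hn⟩ := exists_nat_gt (3 / ε)
  have hn0 : 0 < n := by
    have : (0 : ℝ) < n := (by positivity : 0 < 3 / ε).trans hn
    exact_mod_cast this
  have hfin : ∀ p, cellMeasure (square n p) ≠ ⊤ := fun p =>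
    ((Measure.restrict_apply_le _ _).trans (measure_mono (square_subset_cell n p)) |>.trans_lt
      (by rw [volume_cell]; exact ENNReal.one_lt_top)).ne
  let b : Fin n × Fin n → Lp ℂ 2 cellMeasure := fun p =>
    indicatorConstLp 2 (isOpen_square n p).measurableSet (hfin p) 1
  let W : Submodule ℂ (Lp ℂ 2 cellMeasure) := Submodule.span ℂ (Set.range b)
  have : FiniteDimensional ℂ W := FiniteDimensional.span_of_finite ℂ (Set.finite_range b)
  let e := stdOrthonormalBasis ℂ W
  refine ⟨_, fun j => (e j : Lp ℂ 2 cellMeasure), fun w hw => ?_⟩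
  have hproj : ∑ j, inner ℂ (e j : Lp ℂ 2 cellMeasure) (w 0) • (e j : Lp ℂ 2 cellMeasure) =
      W.starProjection (w 0) := by
    simp [e.starProjection_eq_sum_rankOne]
  rw [hproj]
  choose c hc using fun p : Fin n × Fin n =>
    exists_lintegral_sub_sq_le (a := -1 / 2 + p.1 * (n : ℝ)⁻¹) (b := p.2 * (n : ℝ)⁻¹)
      (h := (n : ℝ)⁻¹) (by positivity) (u := w 0) (g₁ := w 1) (g₂ := w 2)
      (Lp.stronglyMeasurable _).measurable
      (hw.1.mono (square_subset_cell n p)) (hw.2.mono (square_subset_cell n p))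
      ((Lp.memLp _).mono_measure (Measure.restrict_mono (square_subset_cell n p) le_rfl))
      ((Lp.memLp _).mono_measure (Measure.restrict_mono (square_subset_cell n p) le_rfl))
      ((Lp.memLp _).mono_measure (Measure.restrict_mono (square_subset_cell n p) le_rfl))
  let s : Lp ℂ 2 cellMeasure := ∑ p, c p • b p
  have hs : s ∈ W := Submodule.sum_mem _ fun p _ => W.smul_mem _ (Submodule.subset_span ⟨p, rfl⟩)
  -- `W` consists of the functions constant on each square. The orthogonal projection is at least as
  -- good as the competitor `s`, whose values `c p` come from Poincaré's inequality.
  have hle : ‖w 0 - W.starProjection (w 0)‖ ≤ ‖w 0 - s‖ := by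
    rw [Submodule.starProjection_minimal]
    exact ciInf_le ⟨0, by rintro _ ⟨y, rfl⟩; exact norm_nonneg _⟩ (⟨s, hs⟩ : W)
  refine hle.trans ?_
  have hsval : ∀ p, ∀ᵐ x, x ∈ square n p → s x = c p := by
    intro p
    have h1 : ∀ᵐ x, x ∈ cell → s x = ∑ q, (c q • b q) x := by
      have := Lp.coeFn_finsetSum Finset.univ fun q => c q • b q
      filter_upwards [(ae_restrict_iff' isOpen_cell.measurableSet).1 this] with x hx hxc
      exact (hx hxc).trans (Finset.sum_apply _ _ _)
    have h2 : ∀ q, ∀ᵐ x, x ∈ cell → (c q • b q) x = (square n q).indicator (fun _ => c q) x := by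
      intro q
      filter_upwards [(ae_restrict_iff' isOpen_cell.measurableSet).1 (Lp.coeFn_smul (c q) (b q)),
        (ae_restrict_iff' isOpen_cell.measurableSet).1 (indicatorConstLp_coeFn (p := 2)
          (hs := (isOpen_square n q).measurableSet) (hμs := hfin q) (c := (1 : ℂ)))]
        with x hx hx' hxc
      rw [hx hxc, Pi.smul_apply, hx' hxc]
      simp [Set.indicator]
    filter_upwards [h1, ae_all_iff.2 h2] with x hx hx' hxp
    have hxc := square_subset_cell n p hxp
    rw [hx hxc, Finset.sum_congr rfl fun q _ => hx' q hxc, Finset.sum_eq_single p]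
    · exact Set.indicator_of_mem hxp _
    · exact fun q _ hq => Set.indicator_of_notMem
        (Set.disjoint_left.1 (pairwise_disjoint_square n hq.symm) hxp) _
    · simp
  have hsq : ENNReal.ofReal (‖w 0 - s‖ ^ 2) ≤ ENNReal.ofReal (8 * (n : ℝ)⁻¹ ^ 2 * ‖w‖ ^ 2) := by
    have hpw : ∀ᵐ x, x ∈ cell → (w 0 - s) x = w 0 x - s x :=
      (ae_restrict_iff' isOpen_cell.measurableSet).1 (Lp.coeFn_sub (w 0) s)
    rw [ofReal_norm_sq_eq_lintegral, setLIntegral_cell_eq_sum hn0]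
    calc ∑ p, ∫⁻ x in square n p, ‖(w 0 - s) x‖ₑ ^ 2
        = ∑ p, ∫⁻ x in square n p, ‖w 0 x - c p‖ₑ ^ 2 := by
          refine Finset.sum_congr rfl fun p _ => setLIntegral_congr_fun_ae
            (isOpen_square n p).measurableSet ?_
          filter_upwards [hpw, hsval p] with x hx hx' hxp
          rw [hx (square_subset_cell n p hxp), hx' hxp]
      _ ≤ ∑ p, ENNReal.ofReal (8 * (n : ℝ)⁻¹ ^ 2) *
            ∫⁻ x in square n p, (‖w 1 x‖ₑ ^ 2 + ‖w 2 x‖ₑ ^ 2) := Finset.sum_le_sum fun p _ => hc p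
      _ = ENNReal.ofReal (8 * (n : ℝ)⁻¹ ^ 2) *
            ((∫⁻ x in cell, ‖w 1 x‖ₑ ^ 2) + ∫⁻ x in cell, ‖w 2 x‖ₑ ^ 2) := by
          rw [← Finset.mul_sum, ← setLIntegral_cell_eq_sum hn0, lintegral_add_left
            ((Lp.stronglyMeasurable (w 1)).measurable.enorm.pow_const 2)]
      _ = ENNReal.ofReal (8 * (n : ℝ)⁻¹ ^ 2 * (‖w 1‖ ^ 2 + ‖w 2‖ ^ 2)) := by
          rw [← ofReal_norm_sq_eq_lintegral, ← ofReal_norm_sq_eq_lintegral,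
            ← ENNReal.ofReal_add (by positivity) (by positivity),
            ← ENNReal.ofReal_mul (by positivity)]
      _ ≤ ENNReal.ofReal (8 * (n : ℝ)⁻¹ ^ 2 * ‖w‖ ^ 2) := by
          refine ENNReal.ofReal_le_ofReal ?_
          gcongr
          rw [PiLp.norm_sq_eq_of_L2, Fin.sum_univ_three]
          linarith [sq_nonneg ‖w 0‖]
  have hsq' := (ENNReal.ofReal_le_ofReal_iff (by positivity)).1 hsq
  have h3 : 3 * (n : ℝ)⁻¹ ≤ ε := by
    rw [div_lt_iff₀ hε] at hn
    rw [← div_eq_mul_inv, div_le_iff₀ (by positivity)]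
    linarith
  refine le_of_sq_le_sq ?_ (by positivity)
  calc ‖w 0 - s‖ ^ 2 ≤ 8 * (n : ℝ)⁻¹ ^ 2 * ‖w‖ ^ 2 := hsq'
    _ ≤ (3 * (n : ℝ)⁻¹) ^ 2 * ‖w‖ ^ 2 := by
      gcongr
      nlinarith [sq_nonneg ((n : ℝ)⁻¹)]
    _ ≤ ε ^ 2 * ‖w‖ ^ 2 := by gcongr
    _ = (ε * ‖w‖) ^ 2 := by ring

/-! ### Tiling the waveguide and extending antiperiodically -/

theorem isOpen_strip : IsOpen strip := isOpen_univ.prod isOpen_Ioo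

theorem cell_subset_strip : cell ⊆ strip := fun _ hx => ⟨Set.mem_univ _, hx.2⟩

/-- The open bounded piece of the waveguide. -/
abbrev piece (R : ℝ) : Set (ℝ × ℝ) := Set.Ioo (-R) R ×ˢ Set.Ioo 0 1

theorem isOpen_piece (R : ℝ) : IsOpen (piece R) := isOpen_Ioo.prod isOpen_Ioo

theorem volume_piece_ne_top (R : ℝ) : volume (piece R) ≠ ⊤ := by
  rw [Measure.volume_eq_prod, Measure.prod_prod, Real.volume_Ioo, Real.volume_Ioo]
  exact ENNReal.mul_ne_top ENNReal.ofReal_ne_top ENNReal.ofReal_ne_top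

theorem MemL2Loc.locallyIntegrableOn {u : ℝ × ℝ → ℂ} (hu : MemL2Loc u) :
    LocallyIntegrableOn u strip := by
  intro x hx
  have hx' : x ∈ piece (|x.1| + 1) :=
    ⟨⟨by linarith [neg_abs_le x.1], by linarith [le_abs_self x.1]⟩, hx.2⟩
  have : IsFiniteMeasure (volume.restrict (piece (|x.1| + 1))) :=
    ⟨by simpa using (volume_piece_ne_top _).lt_top⟩
  exact ⟨piece (|x.1| + 1), mem_nhdsWithin_of_mem_nhds ((isOpen_piece _).mem_nhds hx'),
    (hu _).integrable (by norm_num)⟩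

/-- The cell, translated by the integer `n`. -/
def tile (n : ℤ) : Set (ℝ × ℝ) := (fun x => x - ((n : ℝ), (0 : ℝ))) ⁻¹' cell

theorem isOpen_tile (n : ℤ) : IsOpen (tile n) :=
  isOpen_cell.preimage (continuous_id.sub continuous_const)

theorem mem_tile {n : ℤ} {x : ℝ × ℝ} :
    x ∈ tile n ↔ (n - 1 / 2 < x.1 ∧ x.1 < n + 1 / 2) ∧ 0 < x.2 ∧ x.2 < 1 := by
  simp only [tile, cell, Set.mem_preimage, Set.mem_prod, Set.mem_Ioo, Prod.fst_sub, Prod.snd_sub,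
    sub_zero]
  refine and_congr_left fun _ => and_congr ?_ ?_ <;> constructor <;> intro <;> linarith

theorem tile_subset_strip (n : ℤ) : tile n ⊆ strip := fun _ hx =>
  ⟨Set.mem_univ _, (mem_tile.1 hx).2⟩

theorem ceil_of_mem_tile {n : ℤ} {x : ℝ × ℝ} (hx : x ∈ tile n) : ⌈x.1 - 1 / 2⌉ = n := by
  have := (mem_tile.1 hx).1
  rw [Int.ceil_eq_iff]
  constructor <;> linarith

/-- Only the countably many vertical lines `x₁ = n + 1 / 2` are missed, and their union is null. -/
theorem ae_mem_tile : ∀ᵐ x : ℝ × ℝ, x ∈ strip → x ∈ tile ⌈x.1 - 1 / 2⌉ := by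
  have h1 : ∀ᵐ t : ℝ, t ∉ Set.range fun n : ℤ => (n : ℝ) + 1 / 2 :=
    (Set.countable_range _).ae_notMem _
  have h2 : ∀ᵐ x : ℝ × ℝ, x.1 ∉ Set.range fun n : ℤ => (n : ℝ) + 1 / 2 :=
    Measure.quasiMeasurePreserving_fst.ae h1
  filter_upwards [h2] with x hx hxs
  refine mem_tile.2 ⟨⟨?_, ?_⟩, hxs.2⟩
  · linarith [Int.ceil_lt_add_one (x.1 - 1 / 2)]
  · refine lt_of_le_of_ne (by linarith [Int.le_ceil (x.1 - 1 / 2)]) fun h => hx ⟨_, h.symm⟩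

theorem ae_sub_of_ae {P : ℝ × ℝ → Prop} (h : ∀ᵐ x, P x) (s : ℝ × ℝ) : ∀ᵐ x, P (x - s) :=
  (measurePreserving_sub_right volume s).quasiMeasurePreserving.ae h

/-- To hold almost everywhere on the waveguide, it suffices to hold so on each tile. -/
theorem ae_strip_of_tile {P : ℝ × ℝ → Prop} (h : ∀ n : ℤ, ∀ᵐ x, x ∈ tile n → P x) :
    ∀ᵐ x, x ∈ strip → P x := by
  filter_upwards [ae_mem_tile, ae_all_iff.2 h] with x hx hx' hxs
  exact hx' _ (hx hxs)

theorem qpExtend_of_mem_tile {n : ℤ} {x : ℝ × ℝ} (hx : x ∈ tile n) (z : ℂ) (u : ℝ × ℝ → ℂ) :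
    qpExtend z u x = z ^ n * u (x - ((n : ℝ), (0 : ℝ))) := by
  rw [qpExtend, ceil_of_mem_tile hx]
  congr 2
  ext <;> simp

theorem tile_zero : tile 0 = cell := by
  ext x
  simp [tile, Prod.sub_def]

theorem qpExtend_of_mem_cell {x : ℝ × ℝ} (hx : x ∈ cell) (z : ℂ) (u : ℝ × ℝ → ℂ) :
    qpExtend z u x = u x := by
  rw [← tile_zero] at hx
  rw [qpExtend_of_mem_tile hx]
  simp [Prod.sub_def]

theorem qpExtend_ae_congr {u v : ℝ × ℝ → ℂ} (h : u =ᵐ[cellMeasure] v) (z : ℂ) :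
    ∀ᵐ x, x ∈ strip → qpExtend z u x = qpExtend z v x := by
  refine ae_strip_of_tile fun n => ?_
  have h1 : ∀ᵐ x, x ∈ cell → u x = v x := (ae_restrict_iff' isOpen_cell.measurableSet).1 h
  filter_upwards [ae_sub_of_ae h1 ((n : ℝ), (0 : ℝ))] with x hx hxn
  rw [qpExtend_of_mem_tile hxn, qpExtend_of_mem_tile hxn, hx hxn]

theorem measurable_qpExtend (z : ℂ) {u : ℝ × ℝ → ℂ} (hu : Measurable u) :
    Measurable (qpExtend z u) := by
  have hc : Measurable fun x : ℝ × ℝ => ⌈x.1 - 1 / 2⌉ :=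
    (measurable_fst.sub_const _).ceil
  refine ((measurable_from_top (f := fun n : ℤ => z ^ n)).comp hc).mul (hu.comp ?_)
  exact (measurable_fst.sub ((measurable_from_top (f := fun n : ℤ => (n : ℝ))).comp hc)).prodMk
    measurable_snd

/-- The antiperiodic extension. -/
noncomputable abbrev ext (u : ℝ × ℝ → ℂ) : ℝ × ℝ → ℂ := qpExtend (-1) u

theorem ext_add_int (u : ℝ × ℝ → ℂ) (x : ℝ × ℝ) (n : ℤ) :
    ext u (x + ((n : ℝ), (0 : ℝ))) = (-1) ^ n * ext u x := by
  have h : ⌈x.1 + n - 1 / 2⌉ = ⌈x.1 - 1 / 2⌉ + n := by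
    rw [← Int.ceil_add_intCast]; congr 1; ring
  simp only [ext, qpExtend, Prod.fst_add, Prod.snd_add, h, add_zero]
  rw [zpow_add₀ (by norm_num)]
  push_cast
  rw [show x.1 + n - ((⌈x.1 - 1 / 2⌉ : ℝ) + n) = x.1 - ⌈x.1 - 1 / 2⌉ by ring]
  ring

theorem lintegral_tile_ext (n : ℤ) (u : ℝ × ℝ → ℂ) :
    ∫⁻ x in tile n, ‖ext u x‖ₑ ^ 2 = ∫⁻ x in cell, ‖u x‖ₑ ^ 2 := by
  have h1 : ∫⁻ x in tile n, ‖ext u x‖ₑ ^ 2 =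
      ∫⁻ x in tile n, ‖u (x - ((n : ℝ), (0 : ℝ)))‖ₑ ^ 2 := by
    refine setLIntegral_congr_fun (isOpen_tile n).measurableSet fun x hx => ?_
    simp only [ext, qpExtend_of_mem_tile hx, enorm_mul]
    rw [show ‖(-1 : ℂ) ^ n‖ₑ = 1 by
      rw [← ofReal_norm, norm_zpow]; simp, one_mul]
  rw [h1]
  exact (measurePreserving_sub_right volume ((n : ℝ), (0 : ℝ))).setLIntegral_comp_preimage_emb
    (MeasurableEquiv.subRight ((n : ℝ), (0 : ℝ))).measurableEmbedding (fun x => ‖u x‖ₑ ^ 2) cell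

/-- Up to a null set the piece is covered by the `2 N + 1` tiles numbered `-N` to `N`, and each
contributes equally since the sign `(-1) ^ n` has modulus one. -/
theorem lintegral_piece_ext_le (N : ℕ) (u : ℝ × ℝ → ℂ) :
    ∫⁻ x in piece N, ‖ext u x‖ₑ ^ 2 ≤ (2 * N + 1 : ℕ) * ∫⁻ x in cell, ‖u x‖ₑ ^ 2 := by
  have hsub : piece N ≤ᵐ[volume] ⋃ n : Finset.Icc (-N : ℤ) N, tile n := by
    filter_upwards [ae_mem_tile] with x hx hxp
    have hxt := hx ⟨Set.mem_univ _, hxp.2⟩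
    refine Set.mem_iUnion.2 ⟨⟨_, Finset.mem_Icc.2 ⟨?_, ?_⟩⟩, hxt⟩
    · change -(N : ℤ) ≤ ⌈x.1 - 1 / 2⌉
      by_contra h
      have h1 : ⌈x.1 - 1 / 2⌉ + 1 ≤ (-N : ℤ) := by omega
      have h2 : ((⌈x.1 - 1 / 2⌉ : ℝ)) + 1 ≤ -N := by exact_mod_cast h1
      linarith [Int.le_ceil (x.1 - 1 / 2), hxp.1.1]
    · change ⌈x.1 - 1 / 2⌉ ≤ (N : ℤ)
      rw [Int.ceil_le]
      have := hxp.1.2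
      push_cast
      linarith
  refine (lintegral_mono' (Measure.restrict_mono' hsub le_rfl) le_rfl).trans ?_
  refine (lintegral_iUnion_le _ _).trans ?_
  rw [tsum_fintype]
  simp only [lintegral_tile_ext, Finset.sum_const, nsmul_eq_mul]
  gcongr
  simp
  omega

theorem memL2Loc_ext {u : ℝ × ℝ → ℂ} (hum : Measurable u) (hu : MemLp u 2 cellMeasure) :
    MemL2Loc (ext u) := by
  intro R
  obtain ⟨N, hN⟩ := exists_nat_ge R
  have : MemLp (ext u) 2 (volume.restrict (piece N)) := by
    refine ⟨(measurable_qpExtend _ hum).aestronglyMeasurable, ?_⟩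
    refine lt_of_pow_lt_pow_left' 2 ?_
    rw [eLpNorm_two_sq, ENNReal.top_pow two_ne_zero]
    refine (lintegral_piece_ext_le N u).trans_lt (ENNReal.mul_lt_top (ENNReal.natCast_lt_top _) ?_)
    rw [← eLpNorm_two_sq]
    exact ENNReal.pow_lt_top hu.2
  exact this.mono_measure (Measure.restrict_mono
    (Set.prod_mono (Set.Ioo_subset_Ioo (by linarith) hN) subset_rfl) le_rfl)

theorem measurable_Lp (u : Lp ℂ 2 cellMeasure) : Measurable u := (Lp.stronglyMeasurable u).measurable

theorem memL2Loc_ext_Lp (u : Lp ℂ 2 cellMeasure) : MemL2Loc (ext u) :=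
  memL2Loc_ext (measurable_Lp u) (Lp.memLp u)

theorem integrable_test_mul_ext {φ : ℝ × ℝ → ℂ} (hφ : IsTest strip φ) (u : Lp ℂ 2 cellMeasure) :
    Integrable (fun x => φ x * ext u x) (volume.restrict strip) :=
  integrable_test_mul (memL2Loc_ext_Lp u).locallyIntegrableOn hφ

theorem IsTest.exists_piece {φ : ℝ × ℝ → ℂ} (hφ : IsTest strip φ) : ∃ N : ℕ, IsTest (piece N) φ := by
  obtain ⟨R, hR⟩ := hφ.2.isCompact.isBounded.subset_ball 0
  obtain ⟨N, hN⟩ := exists_nat_ge R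
  refine ⟨N, hφ.1, hφ.2, fun x hx => ⟨?_, (hφ.3 hx).2⟩⟩
  have h1 := hR hx
  rw [mem_ball_zero_iff] at h1
  have h2 := (norm_fst_le x).trans_lt (h1.trans_le hN)
  exact abs_lt.1 h2

theorem ext_add_ae (u v : Lp ℂ 2 cellMeasure) :
    ∀ᵐ x, x ∈ strip → ext (u + v : Lp ℂ 2 cellMeasure) x = ext u x + ext v x := by
  filter_upwards [qpExtend_ae_congr (Lp.coeFn_add u v) (-1)] with x hx hxs
  rw [ext, hx hxs]
  simp [qpExtend, mul_add]

theorem ext_smul_ae (c : ℂ) (u : Lp ℂ 2 cellMeasure) :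
    ∀ᵐ x, x ∈ strip → ext (c • u : Lp ℂ 2 cellMeasure) x = c * ext u x := by
  filter_upwards [qpExtend_ae_congr (Lp.coeFn_smul c u) (-1)] with x hx hxs
  rw [ext, hx hxs]
  simp [qpExtend, mul_left_comm]

/-! ### The antiperiodic Sobolev space `V` -/

/-- Pairing of a test function on the waveguide with the antiperiodic extension. -/
noncomputable def pair {φ : ℝ × ℝ → ℂ} (hφ : IsTest strip φ) : Lp ℂ 2 cellMeasure →L[ℂ] ℂ :=
  LinearMap.mkContinuousOfExistsBound
    { toFun := fun u => ∫ x in strip, φ x * ext u x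
      map_add' := fun u v => by
        rw [← integral_add (integrable_test_mul_ext hφ u) (integrable_test_mul_ext hφ v)]
        refine integral_congr_ae ((ae_restrict_iff' isOpen_strip.measurableSet).2 ?_)
        filter_upwards [ext_add_ae u v] with x hx hxs
        rw [hx hxs, mul_add]
      map_smul' := fun c u => by
        rw [RingHom.id_apply, smul_eq_mul, ← integral_const_mul]
        refine integral_congr_ae ((ae_restrict_iff' isOpen_strip.measurableSet).2 ?_)
        filter_upwards [ext_smul_ae c u] with x hx hxs
        rw [hx hxs, mul_left_comm] } (by
    obtain ⟨N, hN⟩ := hφ.exists_piece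
    refine ⟨(eLpNorm φ 2 (volume.restrict (piece N))).toReal * √(2 * N + 1 : ℕ), fun u => ?_⟩
    have hmem := memL2Loc_ext_Lp u N
    have h1 : ∫ x in strip, φ x * ext u x = ∫ x in piece N, φ x * ext u x := by
      rw [hφ.setIntegral_eq, hN.setIntegral_eq]
    have h2 : (eLpNorm (ext u) 2 (volume.restrict (piece N))).toReal ≤
        √(2 * N + 1 : ℕ) * ‖u‖ := by
      have h3 : eLpNorm (ext u) 2 (volume.restrict (piece N)) ^ 2 ≤
          ENNReal.ofReal ((√(2 * N + 1 : ℕ) * ‖u‖) ^ 2) := by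
        rw [eLpNorm_two_sq, mul_pow, Real.sq_sqrt (by positivity),
          ENNReal.ofReal_mul (by positivity), ofReal_norm_sq_eq_lintegral, ENNReal.ofReal_natCast]
        exact lintegral_piece_ext_le N u
      rw [ENNReal.ofReal_pow (by positivity)] at h3
      have h4 := (ENNReal.pow_le_pow_left_iff two_ne_zero).1 h3
      exact ENNReal.toReal_le_of_le_ofReal (by positivity) h4
    refine (congrArg norm h1).trans_le ((norm_integral_mul_le (hN.memLp 2 _) hmem).trans ?_)
    rw [mul_assoc]
    gcongr)

theorem pair_apply {φ : ℝ × ℝ → ℂ} (hφ : IsTest strip φ) (u : Lp ℂ 2 cellMeasure) :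
    pair hφ u = ∫ x in strip, φ x * ext u x := rfl

theorem pair_of_cell {φ : ℝ × ℝ → ℂ} (hφ : IsTest cell φ) (u : Lp ℂ 2 cellMeasure) :
    pair (hφ.mono cell_subset_strip) u = ∫ x in cell, φ x * u x := by
  rw [pair_apply, (hφ.mono cell_subset_strip).setIntegral_eq, ← hφ.setIntegral_eq]
  refine setIntegral_congr_fun isOpen_cell.measurableSet fun x hx => ?_
  simp only [ext, qpExtend_of_mem_cell hx]

theorem eq_of_pair_cell {u v : Lp ℂ 2 cellMeasure}
    (h : ∀ φ (hφ : IsTest cell φ), pair (hφ.mono cell_subset_strip) u =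
      pair (hφ.mono cell_subset_strip) v) : u = v := by
  refine Lp.ext ((ae_restrict_iff' isOpen_cell.measurableSet).2 ?_)
  refine ae_eq_of_test isOpen_cell (MemLp.locallyIntegrableOn (Lp.memLp u))
    (MemLp.locallyIntegrableOn (Lp.memLp v)) fun φ hφ => ?_
  rw [← pair_of_cell hφ, ← pair_of_cell hφ, h φ hφ]

/-- Expressed by continuous functionals on `L²` of the cell, weak differentiability across the sides
of the cell becomes a closed linear condition. This is what makes `V` a Hilbert space. -/
theorem isWeakDeriv_ext_iff {e : ℝ × ℝ} {u g : Lp ℂ 2 cellMeasure} :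
    IsWeakDeriv strip e (ext u) (ext g) ↔
      ∀ φ (hφ : IsTest strip φ), pair (hφ.fderiv_apply e) u + pair hφ g = 0 := by
  constructor
  · intro h φ hφ
    rw [pair_apply, pair_apply, h.test (memL2Loc_ext_Lp u).locallyIntegrableOn
      (memL2Loc_ext_Lp g).locallyIntegrableOn hφ, neg_add_cancel]
  · intro h
    exact isWeakDeriv_of_test fun φ hφ => eq_neg_of_add_eq_zero_left (h φ hφ)

theorem isWeakDeriv_cell_iff {e : ℝ × ℝ} {u g : Lp ℂ 2 cellMeasure} :
    IsWeakDeriv cell e u g ↔ ∀ φ (hφ : IsTest cell φ),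
      pair ((hφ.fderiv_apply e).mono cell_subset_strip) u +
        pair (hφ.mono cell_subset_strip) g = 0 := by
  constructor
  · intro h φ hφ
    rw [pair_of_cell hφ, pair_of_cell (hφ.fderiv_apply e),
      h.test (MemLp.locallyIntegrableOn (Lp.memLp u)) (MemLp.locallyIntegrableOn (Lp.memLp g)) hφ,
      neg_add_cancel]
  · intro h
    refine isWeakDeriv_of_test fun φ hφ => ?_
    have := h φ hφ
    rw [pair_of_cell hφ, pair_of_cell (hφ.fderiv_apply e)] at this
    exact eq_neg_of_add_eq_zero_left this

/-- The ambient Hilbert space of triples `(w, ∂₁ w, ∂₂ w)`. -/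
abbrev Triple := PiLp 2 fun _ : Fin 3 => Lp ℂ 2 cellMeasure

/-- The `i`-th component of a triple. -/
noncomputable abbrev comp (i : Fin 3) : Triple →L[ℂ] Lp ℂ 2 cellMeasure :=
  PiLp.proj 2 (fun _ : Fin 3 => Lp ℂ 2 cellMeasure) i

/-- The antiperiodic Sobolev space. -/
noncomputable def V : Submodule ℂ Triple :=
  (⨅ (φ : ℝ × ℝ → ℂ) (hφ : IsTest strip φ),
    LinearMap.ker ((pair (hφ.fderiv_apply (1, 0))).comp (comp 0) + (pair hφ).comp (comp 1)).toLinearMap) ⊓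
  ⨅ (φ : ℝ × ℝ → ℂ) (hφ : IsTest strip φ),
    LinearMap.ker ((pair (hφ.fderiv_apply (0, 1))).comp (comp 0) + (pair hφ).comp (comp 2)).toLinearMap

theorem mem_V_iff {w : Triple} : w ∈ V ↔
    (∀ φ (hφ : IsTest strip φ), pair (hφ.fderiv_apply (1, 0)) (w 0) + pair hφ (w 1) = 0) ∧
    ∀ φ (hφ : IsTest strip φ), pair (hφ.fderiv_apply (0, 1)) (w 0) + pair hφ (w 2) = 0 := by
  simp [V, Submodule.mem_iInf]

theorem mem_H1_iff {w : Triple} : w ∈ H1 ↔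
    (∀ φ (hφ : IsTest cell φ), pair ((hφ.fderiv_apply (1, 0)).mono cell_subset_strip) (w 0) +
      pair (hφ.mono cell_subset_strip) (w 1) = 0) ∧
    ∀ φ (hφ : IsTest cell φ), pair ((hφ.fderiv_apply (0, 1)).mono cell_subset_strip) (w 0) +
      pair (hφ.mono cell_subset_strip) (w 2) = 0 := by
  rw [← isWeakDeriv_cell_iff, ← isWeakDeriv_cell_iff]
  rfl

theorem isClosed_V : IsClosed (V : Set Triple) := by
  have : (V : Set Triple) = {w | w ∈ V} := rfl
  rw [this]
  simp only [mem_V_iff, Set.ofPred_and, Set.ofPred_forall]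
  refine IsClosed.inter ?_ ?_ <;>
  exact isClosed_iInter fun φ => isClosed_iInter fun hφ => isClosed_eq (by fun_prop) (by fun_prop)

theorem isClosed_H1 : IsClosed (H1 : Set Triple) := by
  have : (H1 : Set Triple) = {w | w ∈ H1} := rfl
  rw [this]
  simp only [mem_H1_iff, Set.ofPred_and, Set.ofPred_forall]
  refine IsClosed.inter ?_ ?_ <;>
  exact isClosed_iInter fun φ => isClosed_iInter fun hφ => isClosed_eq (by fun_prop) (by fun_prop)

instance : CompleteSpace V := isClosed_V.completeSpace_coe

instance : CompleteSpace H1 := isClosed_H1.completeSpace_coe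

theorem V_le_H1 : V ≤ H1 := fun _ hw =>
  mem_H1_iff.2 ⟨fun _ hφ => (mem_V_iff.1 hw).1 _ (hφ.mono cell_subset_strip),
    fun _ hφ => (mem_V_iff.1 hw).2 _ (hφ.mono cell_subset_strip)⟩

theorem IsWeakDeriv.translate {U : Set (ℝ × ℝ)} {e : ℝ × ℝ} {u g : ℝ × ℝ → ℂ}
    (h : IsWeakDeriv U e u g) (hu : LocallyIntegrableOn u U) (hg : LocallyIntegrableOn g U)
    (s : ℝ × ℝ) :
    IsWeakDeriv ((fun x => x - s) ⁻¹' U) e (fun x => u (x - s)) fun x => g (x - s) := by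
  refine isWeakDeriv_of_test fun φ hφ => ?_
  have ht : IsTest U fun x => φ (x - -s) := hφ.translate _ fun x hx => hφ.3 hx
  have h1 := h.test hu hg ht
  rw [ht.setIntegral_eq, (ht.fderiv_apply e).setIntegral_eq] at h1
  rw [hφ.setIntegral_eq, (hφ.fderiv_apply e).setIntegral_eq, ← integral_add_right_eq_self _ s,
    ← integral_add_right_eq_self (fun x => φ x * g (x - s)) s]
  simpa [fderiv_comp_sub, fderiv_comp_add_right] using h1

theorem isWeakDeriv_tile {e : ℝ × ℝ} {u g : Lp ℂ 2 cellMeasure} (h : IsWeakDeriv cell e u g)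
    (z : ℂ) (n : ℤ) : IsWeakDeriv (tile n) e (qpExtend z u) (qpExtend z g) := by
  have h1 := (h.translate (MemLp.locallyIntegrableOn (Lp.memLp u))
    (MemLp.locallyIntegrableOn (Lp.memLp g)) ((n : ℝ), (0 : ℝ))).const_smul (z ^ n)
  refine h1.congr ?_ ?_ <;>
  · refine (ae_restrict_iff' (isOpen_tile n).measurableSet).2 (ae_of_all _ fun x hx => ?_)
    rw [qpExtend_of_mem_tile hx]
    rfl

/-- The derivatives provided by `H¹_loc` are a priori arbitrary functions on the strip. On each tile
uniqueness of weak derivatives identifies them with the extended cell derivatives, and the tiles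
fill the strip up to a null set. -/
theorem isQuasiPeriodic_iff_mem_V (w : H1) : IsQuasiPeriodic (-1) w ↔ (w : Triple) ∈ V := by
  rw [mem_V_iff, ← isWeakDeriv_ext_iff, ← isWeakDeriv_ext_iff]
  constructor
  · rintro ⟨h0, g₁, g₂, hg₁, hg₂, h1, h2⟩
    have key : ∀ (e : ℝ × ℝ) (g : ℝ × ℝ → ℂ) (i : Fin 3), MemL2Loc g →
        IsWeakDeriv strip e (qpExtend (-1) (fn w)) g →
        IsWeakDeriv cell e ((w : Triple) 0) ((w : Triple) i) →
        IsWeakDeriv strip e (ext ((w : Triple) 0)) (ext ((w : Triple) i)) := by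
      intro e g i hg hd hc
      refine IsWeakDeriv.congr hd (ae_of_all _ fun x => rfl) ?_
      refine (ae_restrict_iff' isOpen_strip.measurableSet).2 (ae_strip_of_tile fun n => ?_)
      exact (hd.mono (tile_subset_strip n)).unique (isWeakDeriv_tile hc (-1) n) (isOpen_tile n)
        (h0.locallyIntegrableOn.mono_set (tile_subset_strip n))
        (hg.locallyIntegrableOn.mono_set (tile_subset_strip n))
        ((memL2Loc_ext_Lp _).locallyIntegrableOn.mono_set (tile_subset_strip n))
    exact ⟨key _ _ 1 hg₁ h1 w.2.1, key _ _ 2 hg₂ h2 w.2.2⟩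
  · rintro ⟨h1, h2⟩
    exact ⟨memL2Loc_ext_Lp _, _, _, memL2Loc_ext_Lp _, memL2Loc_ext_Lp _, h1, h2⟩

/-! ### Translations along the waveguide -/

/-- By Fubini, on each horizontal line this is the integral of a `1`-periodic function over a full
period. -/
theorem setIntegral_cell_translate {F : ℝ × ℝ → ℂ} (hper : ∀ x, F (x + (1, 0)) = F x)
    (hint : ∀ R, IntegrableOn F (piece R)) (s : ℝ) :
    ∫ x in cell, F (x + (s, 0)) = ∫ x in cell, F x := by
  have hsl : ∀ G : ℝ × ℝ → ℂ, IntegrableOn G cell →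
      ∫ x in cell, G x = ∫ y in Set.Ioo (0 : ℝ) 1, ∫ x in (-1 / 2 : ℝ)..(1 / 2), G (x, y) := by
    intro G hG
    rw [IntegrableOn, cell, Measure.volume_eq_prod, ← Measure.prod_restrict] at hG
    rw [cell, Measure.volume_eq_prod, ← Measure.prod_restrict, integral_prod_symm _ hG]
    refine integral_congr_ae (ae_of_all _ fun y => ?_)
    simp only
    rw [intervalIntegral.integral_of_le (by norm_num), integral_Ioc_eq_integral_Ioo]
  have hmp := (measurePreserving_add_right (volume : Measure (ℝ × ℝ)) (s, 0)).restrict_preimage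
    (isOpen_piece (|s| + 1)).measurableSet
  have hcell : cell ⊆ (fun x : ℝ × ℝ => x + (s, 0)) ⁻¹' piece (|s| + 1) := by
    rintro x ⟨hx, hy⟩
    refine ⟨⟨?_, ?_⟩, by simpa using hy.1, by simpa using hy.2⟩
    · simp only [Prod.fst_add]; linarith [hx.1, neg_abs_le s]
    · simp only [Prod.fst_add]; linarith [hx.2, le_abs_self s]
  have h1 : IntegrableOn (fun x => F (x + (s, 0))) cell :=
    IntegrableOn.mono_set (hmp.integrable_comp_of_integrable (hint (|s| + 1))) hcell
  have h2 : IntegrableOn F cell := (hint 1).mono_set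
    (Set.prod_mono (Set.Ioo_subset_Ioo (by norm_num) (by norm_num)) subset_rfl)
  rw [hsl _ h1, hsl _ h2]
  refine integral_congr_ae (ae_of_all _ fun y => ?_)
  have hp : Function.Periodic (fun x => F (x, y)) 1 := fun x => by
    simpa using hper (x, y)
  have := hp.intervalIntegral_add_eq (-1 / 2 + s) (-1 / 2)
  simp only [Prod.mk_add_mk, add_zero]
  rw [intervalIntegral.integral_comp_add_right (fun x => F (x, y)) s]
  convert this using 2 <;> ring

theorem memLp_ext_translate (u : Lp ℂ 2 cellMeasure) (s : ℝ) :
    MemLp (fun x => ext u (x + (s, 0))) 2 cellMeasure := by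
  have hmp := (measurePreserving_add_right (volume : Measure (ℝ × ℝ)) (s, 0)).restrict_preimage
    (isOpen_piece (|s| + 1)).measurableSet
  have hcell : cell ⊆ (fun x : ℝ × ℝ => x + (s, 0)) ⁻¹' piece (|s| + 1) := by
    rintro x ⟨hx, hy⟩
    refine ⟨⟨?_, ?_⟩, by simpa using hy.1, by simpa using hy.2⟩
    · simp only [Prod.fst_add]; linarith [hx.1, neg_abs_le s]
    · simp only [Prod.fst_add]; linarith [hx.2, le_abs_self s]
  exact ((memL2Loc_ext_Lp u (|s| + 1)).comp_measurePreserving hmp).mono_measure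
    (Measure.restrict_mono hcell le_rfl)

/-- The two signs cancel: the product of one antiperiodic function with the conjugate of another is
periodic. Hence translations are isometries. -/
theorem inner_ext_translate (v u : Lp ℂ 2 cellMeasure) (s : ℝ) :
    ∫ x in cell, ext u (x + (s, 0)) * star (ext v (x + (s, 0))) = inner ℂ v u := by
  rw [setIntegral_cell_translate (F := fun x => ext u x * star (ext v x)), L2.inner_def]
  · refine setIntegral_congr_fun isOpen_cell.measurableSet fun x hx => ?_
    simp only [ext, qpExtend_of_mem_cell hx]
    rfl
  · intro x
    have := fun u => ext_add_int u x 1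
    simp only [Int.cast_one, zpow_one] at this
    simp [this]
  · intro R
    exact memLp_one_iff_integrable.1
      ((memL2Loc_ext_Lp v R).star.mul (memL2Loc_ext_Lp u R))

theorem ae_ext_translate {P : ℝ × ℝ → Prop} (h : ∀ᵐ x, x ∈ strip → P x) (s : ℝ) :
    ∀ᵐ x, x ∈ strip → P (x + (s, 0)) := by
  filter_upwards [ae_sub_of_ae h (-s, 0)] with x hx hxs
  have : x - (-s, 0) = x + (s, 0) := by ext <;> simp
  rw [this] at hx
  exact hx ⟨Set.mem_univ _, by simpa using hxs.2⟩

theorem ae_cell_of_ae_strip {P : ℝ × ℝ → Prop} (h : ∀ᵐ x, x ∈ strip → P x) :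
    ∀ᵐ x ∂cellMeasure, P x :=
  (ae_restrict_iff' isOpen_cell.measurableSet).2 (h.mono fun _ hx hc => hx (cell_subset_strip hc))

/-- The translations along the waveguide, acting on antiperiodic functions. -/
noncomputable def shift (s : ℝ) : Lp ℂ 2 cellMeasure →ₗᵢ[ℂ] Lp ℂ 2 cellMeasure where
  toFun u := (memLp_ext_translate u s).toLp _
  map_add' u v := by
    rw [← MemLp.toLp_add, MemLp.toLp_eq_toLp_iff]
    exact ae_cell_of_ae_strip (ae_ext_translate (ext_add_ae u v) s)
  map_smul' c u := by
    rw [RingHom.id_apply, ← MemLp.toLp_const_smul, MemLp.toLp_eq_toLp_iff]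
    exact ae_cell_of_ae_strip (ae_ext_translate (ext_smul_ae c u) s)
  norm_map' u := by
    simp only [LinearMap.coe_mk, AddHom.coe_mk]
    rw [← sq_eq_sq₀ (norm_nonneg _) (norm_nonneg _), ← inner_self_eq_norm_sq (𝕜 := ℂ),
      ← inner_self_eq_norm_sq (𝕜 := ℂ), ← inner_ext_translate u u s, L2.inner_def]
    congr 1
    refine integral_congr_ae ((memLp_ext_translate u s).coeFn_toLp.mono fun x hx => ?_)
    simp only [hx]
    rfl

theorem coeFn_shift (s : ℝ) (u : Lp ℂ 2 cellMeasure) :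
    shift s u =ᵐ[cellMeasure] fun x => ext u (x + (s, 0)) :=
  (memLp_ext_translate u s).coeFn_toLp

/-- A translate of an antiperiodic function is antiperiodic, so extending and translating commute;
the group law of `shift` rests on this. -/
theorem ext_shift (s : ℝ) (u : Lp ℂ 2 cellMeasure) :
    ∀ᵐ x, x ∈ strip → ext (shift s u) x = ext u (x + (s, 0)) := by
  refine ae_strip_of_tile fun n => ?_
  have h1 : ∀ᵐ x, x ∈ cell → shift s u x = ext u (x + (s, 0)) :=
    (ae_restrict_iff' isOpen_cell.measurableSet).1 (coeFn_shift s u)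
  filter_upwards [ae_sub_of_ae h1 ((n : ℝ), (0 : ℝ))] with x hx hxn
  rw [ext, qpExtend_of_mem_tile hxn, hx hxn, ← ext_add_int]
  congr 1
  ext <;> simp
  ring

theorem shift_shift (r s : ℝ) (u : Lp ℂ 2 cellMeasure) : shift r (shift s u) = shift (r + s) u := by
  refine Lp.ext ?_
  filter_upwards [coeFn_shift r (shift s u), coeFn_shift (r + s) u,
    ae_cell_of_ae_strip (ae_ext_translate (ext_shift s u) r)] with x h1 h2 h3
  rw [h1, h2, h3]
  congr 1
  ext <;> simp
  ring

theorem shift_zero (u : Lp ℂ 2 cellMeasure) : shift 0 u = u := by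
  refine Lp.ext ?_
  filter_upwards [coeFn_shift 0 u, ae_restrict_mem isOpen_cell.measurableSet] with x h1 hx
  rw [h1]
  simpa [Prod.add_def] using qpExtend_of_mem_cell hx (-1) u

theorem shift_one (u : Lp ℂ 2 cellMeasure) : shift 1 u = -u := by
  refine Lp.ext ?_
  filter_upwards [coeFn_shift 1 u, Lp.coeFn_neg u, ae_restrict_mem isOpen_cell.measurableSet]
    with x h1 h2 hx
  have := ext_add_int u x 1
  simp only [Int.cast_one, zpow_one] at this
  rw [h1, h2, this, ext, qpExtend_of_mem_cell hx]
  simp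

theorem inner_shift_right (s : ℝ) (v u : Lp ℂ 2 cellMeasure) :
    inner ℂ v (shift s u) = inner ℂ (shift (-s) v) u := by
  rw [← (shift (-s)).inner_map_map v, shift_shift, neg_add_cancel, shift_zero]

theorem IsTest.shift {φ : ℝ × ℝ → ℂ} (hφ : IsTest strip φ) (s : ℝ) :
    IsTest strip fun x => φ (x - (s, 0)) :=
  hφ.translate _ fun _ hx => ⟨Set.mem_univ _, by simpa using (hφ.3 hx).2⟩

theorem pair_shift {φ : ℝ × ℝ → ℂ} (hφ : IsTest strip φ) (s : ℝ) (u : Lp ℂ 2 cellMeasure) :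
    pair hφ (shift s u) = pair (hφ.shift s) u := by
  have h1 : pair hφ (shift s u) = ∫ x in strip, φ x * ext u (x + (s, 0)) := by
    rw [pair_apply]
    refine integral_congr_ae ((ae_restrict_iff' isOpen_strip.measurableSet).2 ?_)
    filter_upwards [ext_shift s u] with x hx hxs
    rw [hx hxs]
  rw [h1, hφ.setIntegral_eq, pair_apply, (hφ.shift s).setIntegral_eq,
    ← integral_add_right_eq_self (fun x => φ (x - (s, 0)) * ext u x) ((s, 0) : ℝ × ℝ)]
  simp

theorem pair_shift_fderiv {φ : ℝ × ℝ → ℂ} (hφ : IsTest strip φ) (e : ℝ × ℝ) (s : ℝ)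
    (u : Lp ℂ 2 cellMeasure) :
    pair ((hφ.shift s).fderiv_apply e) u = pair (hφ.fderiv_apply e) (shift s u) := by
  rw [pair_shift, pair_apply, pair_apply]
  simp only [fderiv_comp_sub]

/-- The translation is carried by the test function, so the orbit of any `u` in `L²`, smooth or not,
is weakly differentiable. -/
theorem hasDerivAt_pair_shift {φ : ℝ × ℝ → ℂ} (hφ : IsTest strip φ) (u : Lp ℂ 2 cellMeasure)
    (s : ℝ) : HasDerivAt (fun s => pair hφ (shift s u))
      (-pair (hφ.fderiv_apply (1, 0)) (shift s u)) s := by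
  obtain ⟨N, hN⟩ := hφ.exists_piece
  let Q := piece (N + |s| + 1)
  have hfin : IsFiniteMeasure (volume.restrict Q) :=
    ⟨by simpa using (volume_piece_ne_top _).lt_top⟩
  have hu1 : Integrable (ext u) (volume.restrict Q) := (memL2Loc_ext_Lp u _).integrable (by norm_num)
  have hQ : ∀ r ∈ Metric.ball s 1, ∀ ψ, IsTest (piece N) ψ → IsTest Q fun x => ψ (x - (r, 0)) := by
    intro r hr ψ hψ
    refine hψ.translate _ fun x hx => ?_
    have h1 := hψ.3 hx
    rw [Metric.mem_ball, Real.dist_eq] at hr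
    have h2 := abs_lt.1 hr
    refine ⟨⟨?_, ?_⟩, by simpa using h1.2.1, by simpa using h1.2.2⟩
    · simp only [Prod.fst_add]; linarith [h1.1.1, neg_abs_le s]
    · simp only [Prod.fst_add]; linarith [h1.1.2, le_abs_self s]
  have hval : ∀ r ∈ Metric.ball s 1, ∀ ψ (hψ : IsTest strip ψ), IsTest (piece N) ψ →
      pair hψ (shift r u) = ∫ x in Q, ψ (x - r • (1, 0)) * ext u x := by
    intro r hr ψ hψ hψN
    have h1 := hQ r hr ψ hψN
    rw [pair_shift, pair_apply, (hψ.shift r).setIntegral_eq, ← h1.setIntegral_eq]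
    simp [Q]
  have hd := hφ.hasDerivAt_integral_translate hu1 (1, 0) s
  rw [hval s (Metric.mem_ball_self one_pos) _ (hφ.fderiv_apply _) (hN.fderiv_apply _),
    ← integral_neg]
  simp only [← neg_mul]
  refine hd.congr_of_eventuallyEq ?_
  filter_upwards [Metric.ball_mem_nhds s one_pos] with r hr using hval r hr φ hφ hN

/-- Joint measurability and Fubini allow averaging over `s` in the weak sense; continuity of `s ↦
shift s u` is never required. -/
theorem stronglyMeasurable_inner_shift (v u : Lp ℂ 2 cellMeasure) :
    StronglyMeasurable fun s => inner ℂ v (shift s u) := by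
  have h1 : (fun s => inner ℂ v (shift s u)) =
      fun s : ℝ => ∫ x in cell, ext u (x + (s, 0)) * star (v x) := by
    funext s
    rw [L2.inner_def]
    refine integral_congr_ae ((coeFn_shift s u).mono fun x hx => ?_)
    simp [hx]
  rw [h1]
  refine StronglyMeasurable.integral_prod_right' (f := fun p : ℝ × (ℝ × ℝ) =>
    ext u (p.2 + (p.1, 0)) * star (v p.2)) ?_
  refine Measurable.stronglyMeasurable ?_
  refine ((measurable_qpExtend _ (measurable_Lp u)).comp ?_).mul
    (continuous_star.measurable.comp ((measurable_Lp v).comp measurable_snd))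
  exact measurable_snd.add (measurable_fst.prodMk measurable_const)

theorem intervalIntegrable_inner_shift (v u : Lp ℂ 2 cellMeasure) (a b : ℝ) :
    IntervalIntegrable (fun s => inner ℂ v (shift s u)) volume a b := by
  refine (intervalIntegrable_const (c := ‖v‖ * ‖u‖)).mono_fun'
    (stronglyMeasurable_inner_shift v u).aestronglyMeasurable (ae_of_all _ fun s => ?_)
  exact (norm_inner_le_norm _ _).trans_eq (by rw [(shift s).norm_map])

/-! ### The bounded inverse of `∂₁` on antiperiodic functions -/

/-- The sesquilinear form of the antiperiodic primitive. -/
noncomputable def primitiveForm :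
    Lp ℂ 2 cellMeasure →L⋆[ℂ] Lp ℂ 2 cellMeasure →L[ℂ] ℂ :=
  LinearMap.mkContinuous₂
    (LinearMap.mk₂'ₛₗ (starRingEnd ℂ) (RingHom.id ℂ)
      -- The factor comes from `u (x + 1) - u x = -2 u x`: integrating `∂₁ u` over one period to the
      -- right of `x` returns `-2 u x`.
      (fun v u => -(1 / 2) * ∫ s in (0 : ℝ)..1, inner ℂ v (shift s u))
      (fun v v' u => by
        simp only [inner_add_left]
        rw [intervalIntegral.integral_add (intervalIntegrable_inner_shift v u _ _)
          (intervalIntegrable_inner_shift v' u _ _), mul_add])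
      (fun c v u => by
        simp only [inner_smul_left, intervalIntegral.integral_const_mul, smul_eq_mul]
        ring)
      (fun v u u' => by
        simp only [map_add, inner_add_right]
        rw [intervalIntegral.integral_add (intervalIntegrable_inner_shift v u _ _)
          (intervalIntegrable_inner_shift v u' _ _), mul_add])
      (fun c v u => by
        simp only [map_smul, inner_smul_right, intervalIntegral.integral_const_mul, smul_eq_mul,
          RingHom.id_apply]
        ring)) 1 (fun v u => by
    simp only [LinearMap.mk₂'ₛₗ_apply, norm_mul]
    have h1 : ‖∫ s in (0 : ℝ)..1, inner ℂ v (shift s u)‖ ≤ ‖v‖ * ‖u‖ * |1 - 0| := by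
      refine intervalIntegral.norm_integral_le_of_norm_le_const fun s _ => ?_
      exact (norm_inner_le_norm _ _).trans_eq (by rw [(shift s).norm_map])
    have h2 : ‖(-(1 / 2) : ℂ)‖ = 1 / 2 := by simp
    rw [h2]
    simp only [sub_zero, abs_one, mul_one] at h1
    nlinarith [norm_nonneg (∫ s in (0 : ℝ)..1, inner ℂ v (shift s u)), norm_nonneg v,
      norm_nonneg u])

/-- The antiperiodic primitive with respect to `x₁`. -/
noncomputable def primitive : Lp ℂ 2 cellMeasure →L[ℂ] Lp ℂ 2 cellMeasure :=
  (InnerProductSpace.continuousLinearMapOfBilin primitiveForm).adjoint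

theorem inner_primitive (v u : Lp ℂ 2 cellMeasure) :
    inner ℂ v (primitive u) = -(1 / 2) * ∫ s in (0 : ℝ)..1, inner ℂ v (shift s u) := by
  rw [primitive, ContinuousLinearMap.adjoint_inner_right,
    InnerProductSpace.continuousLinearMapOfBilin_apply]
  rfl

theorem apply_primitive (ℓ : Lp ℂ 2 cellMeasure →L[ℂ] ℂ) (u : Lp ℂ 2 cellMeasure) :
    ℓ (primitive u) = -(1 / 2) * ∫ s in (0 : ℝ)..1, ℓ (shift s u) := by
  have h : ∀ w, ℓ w = inner ℂ ((InnerProductSpace.toDual ℂ _).symm ℓ) w := fun w => by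
    rw [InnerProductSpace.toDual_symm_apply]
  simp only [h, inner_primitive]

/-- The adjoint of `shift s` is `shift (-s)`, which by antiperiodicity is `-shift (1 - s)`; the
substitution `s ↦ 1 - s` preserves the integral over the period. -/
theorem inner_primitive_left (v u : Lp ℂ 2 cellMeasure) :
    inner ℂ (primitive v) u = -inner ℂ v (primitive u) := by
  have h1 : ∀ s, inner ℂ v (shift s u) = -inner ℂ (shift (1 - s) v) u := fun s => by
    rw [inner_shift_right, show (1 : ℝ) - s = 1 + -s by ring, ← shift_shift, shift_one,
      inner_neg_left, neg_neg]
  have h2 := intervalIntegral.integral_comp_sub_left (fun s => inner ℂ (shift s v) u) (1 : ℝ)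
    (a := 0) (b := 1)
  simp only [sub_self, sub_zero] at h2
  rw [← inner_conj_symm, inner_primitive, inner_primitive]
  simp only [h1, intervalIntegral.integral_neg, h2]
  simp only [map_mul, map_neg, map_div₀, map_one, map_ofNat]
  rw [intervalIntegral.integral_of_le zero_le_one, intervalIntegral.integral_of_le zero_le_one,
    ← integral_conj]
  simp only [inner_conj_symm]
  ring

/-- The fundamental theorem of calculus along the orbit `s ↦ shift s (w 0)`, paired with test
functions: the increment over one period is `-2 w 0`, because `shift 1 = -1`. -/
theorem primitive_deriv {w : Triple} (hw : w ∈ V) : primitive (w 1) = w 0 := by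
  refine eq_of_pair_cell fun φ hφ => ?_
  have hs := hφ.mono cell_subset_strip
  rw [apply_primitive]
  have h1 : ∀ s, pair hs (shift s (w 1)) = -pair (hs.fderiv_apply (1, 0)) (shift s (w 0)) := by
    intro s
    rw [pair_shift, ← pair_shift_fderiv hs]
    exact eq_neg_of_add_eq_zero_right ((mem_V_iff.1 hw).1 _ (hs.shift s))
  have h2 := intervalIntegral.integral_eq_sub_of_hasDerivAt (a := 0) (b := 1)
    (fun s _ => hasDerivAt_pair_shift hs (w 0) s)
    ((continuous_iff_continuousAt.2 fun s => (hasDerivAt_pair_shift (hs.fderiv_apply (1, 0))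
      (w 0) s).continuousAt).neg.intervalIntegrable _ _)
  simp only [h1]
  rw [h2, shift_one, shift_zero, map_neg]
  ring

theorem intervalIntegrable_apply_shift (ℓ : Lp ℂ 2 cellMeasure →L[ℂ] ℂ) (u : Lp ℂ 2 cellMeasure)
    (a b : ℝ) : IntervalIntegrable (fun s => ℓ (shift s u)) volume a b := by
  have h : ∀ w, ℓ w = inner ℂ ((InnerProductSpace.toDual ℂ _).symm ℓ) w := fun w => by
    rw [InnerProductSpace.toDual_symm_apply]
  simp only [h]
  exact intervalIntegrable_inner_shift _ _ _ _

/-- Translations preserve the linear conditions defining `V`, hence so does their average. This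
makes the primitive of a solution admissible as a test vector in Thomas' argument. -/
theorem primitive_mem_V {w v : Triple} (hw : w ∈ V) (hv : ∀ i, v i = primitive (w i)) : v ∈ V := by
  rw [mem_V_iff] at hw ⊢
  have key : ∀ (e : ℝ × ℝ) (i : Fin 3),
      (∀ φ (hφ : IsTest strip φ), pair (hφ.fderiv_apply e) (w 0) + pair hφ (w i) = 0) →
      ∀ φ (hφ : IsTest strip φ), pair (hφ.fderiv_apply e) (v 0) + pair hφ (v i) = 0 := by
    intro e i h φ hφ
    rw [hv, hv, apply_primitive, apply_primitive, ← mul_add, ← intervalIntegral.integral_add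
      (intervalIntegrable_apply_shift _ _ _ _) (intervalIntegrable_apply_shift _ _ _ _)]
    have : ∀ s, pair (hφ.fderiv_apply e) (shift s (w 0)) + pair hφ (shift s (w i)) = 0 := fun s => by
      rw [← pair_shift_fderiv hφ, pair_shift]
      exact h _ (hφ.shift s)
    simp [this]
  exact ⟨key _ _ hw.1, key _ _ hw.2⟩

/-! ### The exponential weight as an analytic family of operators -/

theorem IsWeakDeriv.congr_open {U : Set (ℝ × ℝ)} {e : ℝ × ℝ} {u u' g g' : ℝ × ℝ → ℂ}
    (h : IsWeakDeriv U e u g) (hU : IsOpen U) (hu : ∀ᵐ x, x ∈ U → u x = u' x)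
    (hg : ∀ᵐ x, x ∈ U → g x = g' x) : IsWeakDeriv U e u' g' :=
  h.congr ((ae_restrict_iff' hU.measurableSet).2 hu) ((ae_restrict_iff' hU.measurableSet).2 hg)

theorem continuous_weight (a : ℂ) : Continuous (weight a) := (contDiff_weight a).continuous

theorem norm_weight_le {R : ℝ} (a : ℂ) {x : ℝ × ℝ} (hx : x ∈ piece R) :
    ‖weight a x‖ ≤ Real.exp (‖a‖ * R) := by
  rw [weight, Complex.norm_exp]
  refine Real.exp_le_exp.2 ((Complex.re_le_norm _).trans ?_)
  rw [norm_mul, Complex.norm_real]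
  gcongr
  exact (abs_lt.2 hx.1).le

theorem cell_subset_piece : cell ⊆ piece 1 :=
  Set.prod_mono (Set.Ioo_subset_Ioo (by norm_num) (by norm_num)) subset_rfl

theorem memLp_top_weight (a : ℂ) (R : ℝ) : MemLp (weight a) ⊤ (volume.restrict (piece R)) :=
  memLp_top_of_bound (continuous_weight a).aestronglyMeasurable _
    ((ae_restrict_iff' (isOpen_piece R).measurableSet).2 (ae_of_all _ fun _ hx => norm_weight_le a hx))

theorem memLp_top_weight_cell (a : ℂ) : MemLp (weight a) ⊤ cellMeasure :=
  (memLp_top_weight a 1).mono_measure (Measure.restrict_mono cell_subset_piece le_rfl)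

theorem memLp_top_fst_mul_weight (a : ℂ) :
    MemLp (fun x : ℝ × ℝ => (x.1 : ℂ) * weight a x) ⊤ cellMeasure := by
  refine memLp_top_of_bound ((Complex.continuous_ofReal.comp continuous_fst).mul
    (continuous_weight a)).aestronglyMeasurable (1 * Real.exp (‖a‖ * 1))
    ((ae_restrict_iff' isOpen_cell.measurableSet).2 (ae_of_all _ fun x hx => ?_))
  rw [norm_mul, Complex.norm_real]
  gcongr
  · exact (abs_lt.2 (cell_subset_piece hx).1).le
  · exact norm_weight_le a (cell_subset_piece hx)

/-- The weight as an element of `L^∞` of the cell. -/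
noncomputable def weightLp (a : ℂ) : Lp ℂ ⊤ cellMeasure := (memLp_top_weight_cell a).toLp _

theorem isFiniteMeasure_cell : IsFiniteMeasure cellMeasure :=
  ⟨by simp [volume_cell]⟩

/-- Since `|x₁| ≤ 1` on the cell, the Taylor remainder of `exp (h x₁)` is at most `‖h‖²` uniformly
in `x`, so the derivative exists in the sup norm. Differentiability on all of `ℂ` then yields
analyticity of `wt`. -/
theorem hasDerivAt_weightLp (a : ℂ) :
    HasDerivAt weightLp ((memLp_top_fst_mul_weight a).toLp _) a := by
  have := isFiniteMeasure_cell
  rw [hasDerivAt_iff_isLittleO_nhds_zero]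
  refine Asymptotics.IsBigO.trans_isLittleO (g := fun h : ℂ => h ^ 2) ?_
    (Asymptotics.isLittleO_pow_id one_lt_two)
  refine Asymptotics.IsBigO.of_bound (Real.exp (‖a‖ * 1)) ?_
  filter_upwards [Metric.ball_mem_nhds (0 : ℂ) one_pos] with h hh
  rw [mem_ball_zero_iff] at hh
  rw [norm_pow]
  refine (Lp.norm_le_of_ae_bound (μ := cellMeasure) (C := Real.exp (‖a‖ * 1) * ‖h‖ ^ 2)
    (by positivity) ?_).trans_eq (by simp)
  filter_upwards [Lp.coeFn_sub (weightLp (a + h) - weightLp a)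
      (h • (memLp_top_fst_mul_weight a).toLp _), Lp.coeFn_sub (weightLp (a + h)) (weightLp a),
    Lp.coeFn_smul h ((memLp_top_fst_mul_weight a).toLp _),
    (memLp_top_fst_mul_weight a).coeFn_toLp, (memLp_top_weight_cell (a + h)).coeFn_toLp,
    (memLp_top_weight_cell a).coeFn_toLp, ae_restrict_mem isOpen_cell.measurableSet]
    with x h1 h2 h3 h4 h5 h6 hx
  rw [h1, Pi.sub_apply, h2, Pi.sub_apply, h3, Pi.smul_apply, h4, weightLp, weightLp, h5, h6]
  have hfac : weight (a + h) x - weight a x - h • ((x.1 : ℂ) * weight a x) =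
      weight a x * (Complex.exp (h * x.1) - 1 - h * x.1) := by
    rw [weight, weight, add_mul, Complex.exp_add, smul_eq_mul]
    ring
  have hx1 : |x.1| ≤ 1 := (abs_lt.2 (cell_subset_piece hx).1).le
  have hle : ‖h * (x.1 : ℂ)‖ ≤ ‖h‖ := by
    rw [norm_mul, Complex.norm_real]
    exact mul_le_of_le_one_right (norm_nonneg _) hx1
  rw [hfac, norm_mul]
  gcongr
  · exact norm_weight_le a (cell_subset_piece hx)
  · exact (Complex.norm_exp_sub_one_sub_id_le (hle.trans hh.le)).trans (by gcongr)

/-- Multiplication of `L²` functions by `L^∞` functions. -/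
noncomputable def mulOp :
    Lp ℂ ⊤ cellMeasure →L[ℂ] Lp ℂ 2 cellMeasure →L[ℂ] Lp ℂ 2 cellMeasure :=
  (ContinuousLinearMap.mul ℂ ℂ).holderL cellMeasure ⊤ 2 2

theorem coeFn_mulOp (m : Lp ℂ ⊤ cellMeasure) (u : Lp ℂ 2 cellMeasure) :
    mulOp m u =ᵐ[cellMeasure] fun x => m x * u x :=
  (ContinuousLinearMap.mul ℂ ℂ).coeFn_holder (r := 2) m u

/-- Multiplication by the weight. -/
noncomputable def wt (a : ℂ) : Lp ℂ 2 cellMeasure →L[ℂ] Lp ℂ 2 cellMeasure := mulOp (weightLp a)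

theorem coeFn_wt (a : ℂ) (u : Lp ℂ 2 cellMeasure) :
    wt a u =ᵐ[cellMeasure] fun x => weight a x * u x := by
  filter_upwards [coeFn_mulOp (weightLp a) u, (memLp_top_weight_cell a).coeFn_toLp] with x h1 h2
  rw [wt, h1, weightLp, h2]

theorem analyticAt_wt (a : ℂ) : AnalyticAt ℂ wt a := by
  have h : Differentiable ℂ weightLp := fun a => (hasDerivAt_weightLp a).differentiableAt
  exact (mulOp.analyticAt _).comp (h.analyticAt a)

theorem weight_neg_mul (a : ℂ) (x : ℝ × ℝ) : weight (-a) x * weight a x = 1 := by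
  rw [weight, weight, ← Complex.exp_add]
  simp

theorem wt_neg_wt (a : ℂ) (u : Lp ℂ 2 cellMeasure) : wt (-a) (wt a u) = u := by
  refine Lp.ext ?_
  filter_upwards [coeFn_wt (-a) (wt a u), coeFn_wt a u] with x h1 h2
  rw [h1, h2, ← mul_assoc, weight_neg_mul, one_mul]

theorem wt_mulOp (a : ℂ) (m : Lp ℂ ⊤ cellMeasure) (u : Lp ℂ 2 cellMeasure) :
    mulOp m (wt a u) = wt a (mulOp m u) := by
  refine Lp.ext ?_
  filter_upwards [coeFn_wt a (mulOp m u), coeFn_wt a u, coeFn_mulOp m u, coeFn_mulOp m (wt a u)]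
    with x h1 h2 h3 h4
  rw [h4, h2, h1, h3]
  ring

theorem inner_star_left (p q : Lp ℂ 2 cellMeasure) :
    inner ℂ (star p) q = ∫ x in cell, q x * p x := by
  rw [L2.inner_def]
  refine integral_congr_ae ((Lp.coeFn_star p).mono fun x hx => ?_)
  simp [hx]

/-- Multiplication by the weight is symmetric for the bilinear pairing, with no conjugate on `a`.
The weight of a test function can thus pass to the other factor, where `wt (-a)` cancels `wt a`. -/
theorem inner_star_wt (a : ℂ) (p q : Lp ℂ 2 cellMeasure) :
    inner ℂ (star (wt (-a) (star p))) q = inner ℂ p (wt (-a) q) := by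
  rw [inner_star_left, L2.inner_def]
  refine integral_congr_ae ?_
  filter_upwards [coeFn_wt (-a) (star p), coeFn_wt (-a) q, Lp.coeFn_star p] with x h1 h2 h3
  simp only [h1, h2, h3, Pi.star_apply, RCLike.inner_apply, Complex.star_def]
  ring

theorem star_add_smul (p q : Lp ℂ 2 cellMeasure) (c : ℂ) :
    star (p + c • q) = star p + star c • star q := by
  refine Lp.ext ?_
  filter_upwards [Lp.coeFn_star (p + c • q), Lp.coeFn_add p (c • q), Lp.coeFn_smul c q,
    Lp.coeFn_add (star p) (star c • star q), Lp.coeFn_smul (star c) (star q), Lp.coeFn_star p,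
    Lp.coeFn_star q] with x h1 h2 h3 h4 h5 h6 h7
  rw [h1, h4, Pi.star_apply, h2, Pi.add_apply, Pi.add_apply, h3, h5, Pi.smul_apply, Pi.smul_apply,
    h6, h7]
  simp

/-! ### Conjugation and the change of Floquet multiplier -/

/-- Complex conjugation of triples. -/
noncomputable def conjT (w : Triple) : Triple := WithLp.toLp 2 fun i => star (w i)

@[simp]
theorem conjT_apply (w : Triple) (i : Fin 3) : conjT w i = star (w i) := rfl

@[simp]
theorem conjT_conjT (w : Triple) : conjT (conjT w) = w := by
  ext i : 1
  simp

theorem ext_star_ae (u : Lp ℂ 2 cellMeasure) :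
    ∀ᵐ x, x ∈ strip → star (ext u x) = ext (star u : Lp ℂ 2 cellMeasure) x := by
  filter_upwards [qpExtend_ae_congr (Lp.coeFn_star u) (-1)] with x hx hxs
  rw [ext, ext, hx hxs]
  simp [qpExtend]

theorem conjT_mem_V {w : Triple} (hw : w ∈ V) : conjT w ∈ V := by
  rw [mem_V_iff, ← isWeakDeriv_ext_iff, ← isWeakDeriv_ext_iff] at hw ⊢
  exact ⟨hw.1.conj.congr_open isOpen_strip (ext_star_ae _) (ext_star_ae _),
    hw.2.conj.congr_open isOpen_strip (ext_star_ae _) (ext_star_ae _)⟩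

/-- The map `w ↦ exp (a x₁) w`, on triples of a function and its derivatives. -/
noncomputable def gauge (a : ℂ) (w : Triple) : Triple :=
  WithLp.toLp 2 ![wt a (w 0), wt a (w 1 + a • w 0), wt a (w 2)]

@[simp] theorem gauge_zero (a : ℂ) (w : Triple) : gauge a w 0 = wt a (w 0) := rfl

@[simp] theorem gauge_one (a : ℂ) (w : Triple) : gauge a w 1 = wt a (w 1 + a • w 0) := rfl

@[simp] theorem gauge_two (a : ℂ) (w : Triple) : gauge a w 2 = wt a (w 2) := rfl

theorem gauge_neg_gauge (a : ℂ) (w : Triple) : gauge (-a) (gauge a w) = w := by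
  ext i : 1
  fin_cases i
  · simp [wt_neg_wt]
  · change wt (-a) (wt a (w 1 + a • w 0) + -a • wt a (w 0)) = w 1
    rw [map_add, map_smul, wt_neg_wt, wt_neg_wt]
    module
  · simp [wt_neg_wt]

theorem gauge_smul (a c : ℂ) (w : Triple) : gauge a (c • w) = c • gauge a w := by
  ext i : 1
  fin_cases i
  · simp
  · change wt a (c • w 1 + a • c • w 0) = c • wt a (w 1 + a • w 0)
    rw [← map_smul]
    congr 1
    module
  · simp

theorem analyticAt_gauge {ψ : ℂ → ℂ} {u : ℂ → Triple} {z : ℂ} (hψ : AnalyticAt ℂ ψ z)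
    (hu : AnalyticAt ℂ u z) : AnalyticAt ℂ (fun y => gauge (ψ y) (u y)) z := by
  have hc : ∀ i, AnalyticAt ℂ (fun y => u y i) z := fun i => ((comp i).analyticAt _).comp hu
  have hw : AnalyticAt ℂ (fun y => wt (ψ y)) z := (analyticAt_wt (ψ z)).comp hψ
  have h : AnalyticAt ℂ (fun y => (![wt (ψ y) (u y 0), wt (ψ y) (u y 1 + ψ y • u y 0),
      wt (ψ y) (u y 2)] : Fin 3 → Lp ℂ 2 cellMeasure)) z := by
    refine AnalyticAt.pi fun i => ?_
    fin_cases i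
    · exact analyticAt_clm_apply hw (hc 0)
    · exact analyticAt_clm_apply hw ((hc 1).add (hψ.smul (hc 0)))
    · exact analyticAt_clm_apply hw (hc 2)
  exact (((PiLp.continuousLinearEquiv 2 ℂ
    fun _ : Fin 3 => Lp ℂ 2 cellMeasure).symm.toContinuousLinearMap).analyticAt _).comp h

theorem wt_add_ae (a c : ℂ) (p q : Lp ℂ 2 cellMeasure) :
    wt a (p + c • q) =ᵐ[cellMeasure] fun x => weight a x * (p x + c * q x) := by
  filter_upwards [coeFn_wt a (p + c • q), Lp.coeFn_add p (c • q), Lp.coeFn_smul c q] with x h1 h2 h3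
  rw [h1, h2, Pi.add_apply, h3]
  rfl

theorem gauge_mem_H1 {w : Triple} (hw : w ∈ H1) (a : ℂ) : gauge a w ∈ H1 := by
  have hl : ∀ i, LocallyIntegrableOn (w i) cell := fun i =>
    MemLp.locallyIntegrableOn (Lp.memLp (w i))
  refine ⟨IsWeakDeriv.congr (hw.1.weight_mul (hl 0) (hl 1) a) (coeFn_wt a (w 0)).symm ?_,
    IsWeakDeriv.congr (hw.2.weight_mul (hl 0) (hl 2) a) (coeFn_wt a (w 0)).symm ?_⟩
  · filter_upwards [wt_add_ae a a (w 1) (w 0)] with x hx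
    rw [gauge_one, hx]
    simp
  · filter_upwards [coeFn_wt a (w 2)] with x hx
    rw [gauge_two, hx]
    simp

/-- The globally defined weight differs on the `n`-th tile from its translate from the cell by the
factor `exp (n a)`, which is exactly what replacing `z` by `z exp a` absorbs. -/
theorem qpExtend_weight (z a : ℂ) (u : ℝ × ℝ → ℂ) (x : ℝ × ℝ) :
    qpExtend (z * Complex.exp a) (fun x => weight a x * u x) x = weight a x * qpExtend z u x := by
  simp only [qpExtend, weight, mul_zpow, ← Complex.exp_int_mul]
  have : Complex.exp (a * x.1) = Complex.exp (⌈x.1 - 1 / 2⌉ * a) *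
      Complex.exp (a * ((x.1 - ⌈x.1 - 1 / 2⌉ : ℝ) : ℂ)) := by
    rw [← Complex.exp_add]
    congr 1
    push_cast
    ring
  rw [this]
  ring

theorem MemL2Loc.weight_mul {u : ℝ × ℝ → ℂ} (hu : MemL2Loc u) (a : ℂ) :
    MemL2Loc fun x => weight a x * u x := fun R => (hu R).mul (memLp_top_weight a R)

theorem MemL2Loc.congr {u v : ℝ × ℝ → ℂ} (hu : MemL2Loc u) (h : ∀ᵐ x, x ∈ strip → u x = v x) :
    MemL2Loc v := fun R => (memLp_congr_ae ((ae_restrict_iff' (isOpen_piece R).measurableSet).2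
      (h.mono fun _ hx hp => hx ⟨Set.mem_univ _, hp.2⟩))).1 (hu R)

theorem MemL2Loc.add_const_mul {u g : ℝ × ℝ → ℂ} (hg : MemL2Loc g) (hu : MemL2Loc u) (c : ℂ) :
    MemL2Loc fun x => g x + c * u x := fun R => (hg R).add ((hu R).const_mul c)

theorem isQuasiPeriodic_gauge {z : ℂ} {w : H1} (hw : IsQuasiPeriodic z w) (a : ℂ) :
    IsQuasiPeriodic (z * Complex.exp a) ⟨gauge a w, gauge_mem_H1 w.2 a⟩ := by
  obtain ⟨h0, g₁, g₂, hg₁, hg₂, h1, h2⟩ := hw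
  have hae : ∀ᵐ x, x ∈ strip → weight a x * qpExtend z (fn w) x =
      qpExtend (z * Complex.exp a) (fn ⟨gauge a w, gauge_mem_H1 w.2 a⟩) x := by
    filter_upwards [qpExtend_ae_congr (coeFn_wt a ((w : Triple) 0)) (z * Complex.exp a)] with x hx hxs
    rw [← qpExtend_weight]
    exact (hx hxs).symm
  exact ⟨(h0.weight_mul a).congr hae, _, _, (hg₁.add_const_mul h0 _).weight_mul a,
    (hg₂.add_const_mul h0 _).weight_mul a,
    (h1.weight_mul h0.locallyIntegrableOn hg₁.locallyIntegrableOn a).congr_open isOpen_strip hae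
      (ae_of_all _ fun _ _ => rfl),
    (h2.weight_mul h0.locallyIntegrableOn hg₂.locallyIntegrableOn a).congr_open isOpen_strip hae
      (ae_of_all _ fun _ _ => rfl)⟩

/-! ### The operator on `V` and Thomas' argument -/

/-- The components of elements of `V`, as operators. -/
noncomputable def D (i : Fin 3) : V →L[ℂ] Lp ℂ 2 cellMeasure := (comp i).comp V.subtypeL

theorem D_apply (i : Fin 3) (u : V) : D i u = (u : Triple) i := rfl

theorem finiteRankApproximable_D : FiniteRankApproximable (D 0) := fun _ hε => by
  obtain ⟨m, e, h⟩ := exists_finite_rank_approx hε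
  exact ⟨m, e, fun u => h u (V_le_H1 u.2)⟩

/-- Integration by parts without boundary terms, read off from the skew-adjointness of the inverse
of `∂₁` instead of a trace or density theorem. -/
theorem inner_deriv_left {v u : Triple} (hv : v ∈ V) (hu : u ∈ V) :
    inner ℂ (v 0) (u 1) = -inner ℂ (v 1) (u 0) := by
  rw [← primitive_deriv hv, inner_primitive_left, primitive_deriv hu]

/-- The sesquilinear form of the cell problem, after the change of unknown that makes the
problem antiperiodic; `m` is the multiplier `k² q`. -/
noncomputable def form (m : Lp ℂ ⊤ cellMeasure) (a : ℂ) (v u : Triple) : ℂ :=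
  inner ℂ (v 1) (u 1 + a • u 0) - a * inner ℂ (v 0) (u 1 + a • u 0) + inner ℂ (v 2) (u 2) -
    inner ℂ (v 0) (mulOp m (u 0))

/-- The form of the cell problem is represented by `1 + lowerOrder m a ∘ D 0`. -/
noncomputable def lowerOrder (m : Lp ℂ ⊤ cellMeasure) (a : ℂ) : Lp ℂ 2 cellMeasure →L[ℂ] V :=
  (D 1).adjoint.comp ((2 * a) • ContinuousLinearMap.id ℂ _) -
    (D 0).adjoint.comp ((a ^ 2 + 1) • ContinuousLinearMap.id ℂ _ + mulOp m)

/-- Integration by parts merges the two first-order cross terms into `2 a ⟨v 1, u 0⟩`, so no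
derivative of `u` remains in the perturbation. The `1` in `a ^ 2 + 1` offsets the `L²` part of the
`H¹` inner product. -/
theorem inner_lowerOrder (m : Lp ℂ ⊤ cellMeasure) (a : ℂ) (v u : V) :
    inner ℂ v (u + lowerOrder m a (D 0 u)) = form m a v u := by
  have h := inner_deriv_left v.2 u.2
  have hi : inner ℂ v u = ∑ i, inner ℂ ((v : Triple) i) ((u : Triple) i) := by
    rw [← PiLp.inner_apply]
    rfl
  have h1 : inner ℂ v (lowerOrder m a (D 0 u)) =
      2 * a * inner ℂ ((v : Triple) 1) ((u : Triple) 0) -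
        ((a ^ 2 + 1) * inner ℂ ((v : Triple) 0) ((u : Triple) 0) +
          inner ℂ ((v : Triple) 0) (mulOp m ((u : Triple) 0))) := by
    simp only [lowerOrder, sub_apply, smul_apply, ContinuousLinearMap.comp_apply, add_apply,
      ContinuousLinearMap.id_apply, inner_sub_right, inner_smul_right,
      ContinuousLinearMap.adjoint_inner_right, inner_add_right, D_apply]
  rw [inner_add_right, h1, hi, Fin.sum_univ_three, form]
  simp only [inner_add_right, inner_smul_right, h]
  ring

theorem analyticAt_lowerOrder (m : Lp ℂ ⊤ cellMeasure) (a : ℂ) :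
    AnalyticAt ℂ (lowerOrder m) a := by
  have h1 : AnalyticAt ℂ (fun a : ℂ => (2 * a) • ContinuousLinearMap.id ℂ (Lp ℂ 2 cellMeasure)) a :=
    (analyticAt_const.mul analyticAt_id).smul analyticAt_const
  have h2 : AnalyticAt ℂ (fun a : ℂ =>
      (a ^ 2 + 1) • ContinuousLinearMap.id ℂ (Lp ℂ 2 cellMeasure) + mulOp m) a :=
    (((analyticAt_id.pow 2).add analyticAt_const).smul analyticAt_const).add analyticAt_const
  exact (analyticAt_comp_left (D 1).adjoint h1).sub (analyticAt_comp_left (D 0).adjoint h2)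

/-- Thomas' argument: for a large real exponent the homogeneous problem has no solution. -/
theorem exists_injective (m : Lp ℂ ⊤ cellMeasure) :
    ∃ a : ℂ, ∀ u : V, u + lowerOrder m a (D 0 u) = 0 → u = 0 := by
  refine ⟨((‖primitive‖ * ‖mulOp m‖ + 1 : ℝ) : ℂ), fun u hu => ?_⟩
  set t : ℝ := ‖primitive‖ * ‖mulOp m‖ + 1 with ht
  let w : Triple := u
  have hw : w ∈ V := u.2
  -- With this test vector the terms `⟨primitive x, x⟩` are purely imaginary by skew-adjointness and
  -- drop out of the real part.
  let v : Triple := WithLp.toLp 2 fun i => primitive (w i)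
  have hv : v ∈ V := primitive_mem_V hw fun _ => rfl
  have h0 : form m t v w = 0 := by
    rw [← inner_lowerOrder m t ⟨v, hv⟩ u, hu, inner_zero_right]
  have hre : ∀ x, (inner ℂ (primitive x) x).re = 0 := by
    intro x
    have h1 := congrArg Complex.re (inner_primitive_left x x)
    rw [← inner_conj_symm] at h1
    have h2 : (inner ℂ x (primitive x)).re = (inner ℂ (primitive x) x).re := by
      rw [← inner_conj_symm x]
      exact Complex.conj_re _
    rw [inner_conj_symm, Complex.neg_re, h2] at h1
    linarith
  have h1 : primitive (w 1) = w 0 := primitive_deriv hw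
  have h2 : (inner ℂ (w 0) (w 1)).re = 0 := by
    rw [← h1]; exact hre _
  have h3 : inner ℂ (primitive (w 0)) (w 1) = -inner ℂ (w 0) (w 0) := by
    rw [inner_primitive_left, h1]
  have h4 : inner ℂ (w 0) (w 0) = ((‖w 0‖ ^ 2 : ℝ) : ℂ) := by
    rw [inner_self_eq_norm_sq_to_K]; norm_cast
  -- Each of the two cross terms contributes `t ‖w 0‖²`, one through `primitive (w 1) = w 0` and the
  -- other through `h3`.
  have h5 : 2 * t * ‖w 0‖ ^ 2 = (inner ℂ (primitive (w 0)) (mulOp m (w 0))).re := by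
    have h6 := congrArg Complex.re h0
    simp only [form, v, h1, inner_add_right, inner_smul_right, h3, h4, Complex.sub_re,
      Complex.add_re, Complex.re_ofReal_mul, Complex.neg_re, Complex.ofReal_re, h2, hre,
      Complex.zero_re] at h6
    linarith
  have h6 : (inner ℂ (primitive (w 0)) (mulOp m (w 0))).re ≤
      (‖primitive‖ * ‖mulOp m‖) * ‖w 0‖ ^ 2 := by
    calc (inner ℂ (primitive (w 0)) (mulOp m (w 0))).re
        ≤ ‖primitive (w 0)‖ * ‖mulOp m (w 0)‖ :=
          (Complex.re_le_norm _).trans (norm_inner_le_norm _ _)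
      _ ≤ (‖primitive‖ * ‖w 0‖) * (‖mulOp m‖ * ‖w 0‖) := by
          gcongr <;> exact ContinuousLinearMap.le_opNorm _ _
      _ = _ := by ring
  have h7 : ‖w 0‖ ^ 2 ≤ 0 := by
    have : 0 ≤ ‖primitive‖ * ‖mulOp m‖ := by positivity
    nlinarith [sq_nonneg ‖w 0‖]
  have h8 : D 0 u = 0 := norm_eq_zero.1 (pow_eq_zero_iff two_ne_zero |>.1
    (le_antisymm h7 (sq_nonneg _)))
  rw [h8, map_zero, add_zero] at hu
  exact hu

/-! ### From the cell problem to the operator equation -/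

theorem integrable_Lp_mul (p q : Lp ℂ 2 cellMeasure) :
    Integrable (fun x => p x * q x) cellMeasure :=
  memLp_one_iff_integrable.1 ((Lp.memLp q).mul (Lp.memLp p))

section Bridge

variable {k : ℝ} {q : ℝ × ℝ → ℝ} {f : ℝ × ℝ → ℂ}

theorem memLp_multiplier (hq : MemLp q ⊤ cellMeasure) (k : ℝ) :
    MemLp (fun x => (k : ℂ) ^ 2 * (q x : ℂ)) ⊤ cellMeasure :=
  hq.ofReal.const_mul _

theorem isSolution_iff (hq : MemLp q ⊤ cellMeasure) (hf : MemLp f 2 cellMeasure) {z : ℂ} {w : H1} :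
    IsSolution k q f z w ↔ IsQuasiPeriodic z w ∧ ∀ φ : H1, IsQuasiPeriodic z⁻¹ φ →
      inner ℂ (star ((φ : Triple) 1)) ((w : Triple) 1) +
        inner ℂ (star ((φ : Triple) 2)) ((w : Triple) 2) -
          inner ℂ (star ((φ : Triple) 0)) (mulOp ((memLp_multiplier hq k).toLp _) ((w : Triple) 0)) =
        -inner ℂ (star ((φ : Triple) 0)) (hf.toLp f) := by
  refine and_congr_right fun _ => forall₂_congr fun φ _ => ?_
  have h1 : ∫ x in cell, f x * fn φ x = inner ℂ (star ((φ : Triple) 0)) (hf.toLp f) := by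
    rw [inner_star_left]
    exact integral_congr_ae (hf.coeFn_toLp.mono fun x hx => by simp only [hx]; rfl)
  have h2 : ∫ x in cell, (d1 w x * d1 φ x + d2 w x * d2 φ x -
      (k : ℂ) ^ 2 * (q x : ℂ) * fn w x * fn φ x) =
      inner ℂ (star ((φ : Triple) 1)) ((w : Triple) 1) +
        inner ℂ (star ((φ : Triple) 2)) ((w : Triple) 2) -
          inner ℂ (star ((φ : Triple) 0))
            (mulOp ((memLp_multiplier hq k).toLp _) ((w : Triple) 0)) := by
    have hi : Integrable (fun x => (w : Triple) 1 x * (φ : Triple) 1 x +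
        (w : Triple) 2 x * (φ : Triple) 2 x) cellMeasure :=
      (integrable_Lp_mul _ _).add (integrable_Lp_mul _ _)
    rw [inner_star_left, inner_star_left, inner_star_left,
      ← integral_add (integrable_Lp_mul _ _) (integrable_Lp_mul _ _),
      ← integral_sub hi (integrable_Lp_mul _ _)]
    refine integral_congr_ae ?_
    filter_upwards [coeFn_mulOp ((memLp_multiplier hq k).toLp _) ((w : Triple) 0),
      (memLp_multiplier hq k).coeFn_toLp] with x hx hx'
    simp only [hx, hx']
    rfl
  rw [h1, h2]

/-- The right-hand side of the operator equation of the cell problem. -/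
noncomputable def rhs (F : Lp ℂ 2 cellMeasure) (a : ℂ) : V := -(D 0).adjoint (wt (-a) F)

theorem analyticAt_rhs (F : Lp ℂ 2 cellMeasure) (a : ℂ) : AnalyticAt ℂ (rhs F) a := by
  have h1 : AnalyticAt ℂ (fun a => wt (-a)) a := (analyticAt_wt (-a)).comp analyticAt_id.neg
  exact (((D 0).adjoint.analyticAt _).comp (analyticAt_clm_apply h1 analyticAt_const)).neg

theorem inner_rhs (F : Lp ℂ 2 cellMeasure) (a : ℂ) (v : V) :
    inner ℂ v (rhs F a) = -inner ℂ ((v : Triple) 0) (wt (-a) F) := by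
  rw [rhs, inner_neg_right, ContinuousLinearMap.adjoint_inner_right, D_apply]

/-- `gauge a`, with values in `H¹`. -/
noncomputable def gaugeH1 (a : ℂ) (u : H1) : H1 := ⟨gauge a u, gauge_mem_H1 u.2 a⟩

theorem gaugeH1_neg (a : ℂ) (u : H1) : gaugeH1 (-a) (gaugeH1 a u) = u :=
  Subtype.ext (gauge_neg_gauge a u)

theorem gaugeH1_neg' (a : ℂ) (u : H1) : gaugeH1 a (gaugeH1 (-a) u) = u := by
  simpa using gaugeH1_neg (-a) u

theorem isQuasiPeriodic_gaugeH1 {z : ℂ} {u : H1} (hu : IsQuasiPeriodic z u) (a : ℂ) :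
    IsQuasiPeriodic (z * Complex.exp a) (gaugeH1 a u) :=
  isQuasiPeriodic_gauge hu a

/-- The inclusion of `V` into `H¹`. -/
noncomputable abbrev toH1 (u : V) : H1 := ⟨u, V_le_H1 u.2⟩

theorem isQuasiPeriodic_toH1 (u : V) : IsQuasiPeriodic (-1) (toH1 u) :=
  (isQuasiPeriodic_iff_mem_V _).2 u.2

/-- The form of the cell problem in the gauged unknowns. -/
theorem form_gauge (m : Lp ℂ ⊤ cellMeasure) (a : ℂ) (v u : Triple) :
    inner ℂ (star (gauge (-a) (conjT v) 1)) (gauge a u 1) +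
      inner ℂ (star (gauge (-a) (conjT v) 2)) (gauge a u 2) -
        inner ℂ (star (gauge (-a) (conjT v) 0)) (mulOp m (gauge a u 0)) = form m a v u := by
  -- Conjugation turns `-a` into `-star a`; the conjugate-linear first slot of the inner product
  -- turns it back, giving the holomorphic dependence on `a` in `form`.
  have h1 : conjT v 1 + -a • conjT v 0 = star (v 1 + -(star a) • v 0) := by
    rw [star_add_smul]
    simp
  rw [gauge_one, gauge_one, gauge_two, gauge_two, gauge_zero, gauge_zero, h1, wt_mulOp,
    conjT_apply, conjT_apply, inner_star_wt, inner_star_wt, inner_star_wt, wt_neg_wt, wt_neg_wt,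
    wt_neg_wt, form, inner_add_left, inner_smul_left]
  simp
  ring

/-- The cell problem as an operator equation in `V`. -/
theorem isSolution_gauge_iff (hq : MemLp q ⊤ cellMeasure) (hf : MemLp f 2 cellMeasure) (a : ℂ)
    (u : V) : IsSolution k q f (-Complex.exp a) (gaugeH1 a (toH1 u)) ↔
      u + lowerOrder ((memLp_multiplier hq k).toLp _) a (D 0 u) = rhs (hf.toLp f) a := by
  have hz : (-Complex.exp a)⁻¹ = -1 * Complex.exp (-a) := by
    rw [Complex.exp_neg, inv_neg, neg_one_mul]
  have hqp : IsQuasiPeriodic (-Complex.exp a) (gaugeH1 a (toH1 u)) := by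
    simpa using isQuasiPeriodic_gaugeH1 (isQuasiPeriodic_toH1 u) a
  rw [isSolution_iff hq hf, and_iff_right hqp]
  constructor
  · intro h
    refine ext_inner_left ℂ fun v => ?_
    have h1 := h (gaugeH1 (-a) (toH1 ⟨conjT v, conjT_mem_V v.2⟩)) (by
      rw [hz]
      exact isQuasiPeriodic_gaugeH1 (isQuasiPeriodic_toH1 _) (-a))
    rw [inner_lowerOrder, inner_rhs, ← form_gauge]
    refine h1.trans ?_
    change -inner ℂ (star (wt (-a) (star ((v : Triple) 0)))) _ = _
    rw [inner_star_wt]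
  · intro h φ hφ
    -- Removing the weight and conjugating shows that every admissible test function comes from some
    -- `v` in `V`, so testing on `V` loses nothing.
    have hv0 : IsQuasiPeriodic (-1) (gaugeH1 a φ) := by
      have := isQuasiPeriodic_gaugeH1 hφ a
      rwa [hz, mul_assoc, ← Complex.exp_add, neg_add_cancel, Complex.exp_zero, mul_one] at this
    have hv1 : (gaugeH1 a φ : Triple) ∈ V := (isQuasiPeriodic_iff_mem_V _).1 hv0
    let v : V := ⟨conjT (gaugeH1 a φ), conjT_mem_V hv1⟩
    have hφv : (φ : Triple) = gauge (-a) (conjT v) := by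
      rw [conjT_conjT]
      exact (gauge_neg_gauge a φ).symm
    have h1 := congrArg (inner ℂ v) h
    rw [inner_lowerOrder, inner_rhs, ← form_gauge] at h1
    rw [hφv]
    refine h1.trans ?_
    change -inner ℂ ((v : Triple) 0) _ = -inner ℂ (star (wt (-a) (star ((v : Triple) 0)))) _
    rw [inner_star_wt]

theorem IsSolution.exists_gauge {a : ℂ} {w : H1} (hw : IsSolution k q f (-Complex.exp a) w) :
    ∃ u : V, w = gaugeH1 a (toH1 u) := by
  have h := isQuasiPeriodic_gaugeH1 hw.1 (-a)
  rw [neg_mul, ← Complex.exp_add, add_neg_cancel, Complex.exp_zero] at h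
  exact ⟨⟨_, (isQuasiPeriodic_iff_mem_V _).1 h⟩, (gaugeH1_neg' a w).symm⟩

theorem gaugeH1_eq_zero_iff {a : ℂ} {u : V} : gaugeH1 a (toH1 u) = 0 ↔ u = 0 := by
  constructor
  · intro h
    have h1 := gaugeH1_neg a (toH1 u)
    rw [h] at h1
    have h2 : gauge (-a) 0 = (u : Triple) := congrArg Subtype.val h1
    have h3 := gauge_smul (-a) 0 0
    rw [zero_smul, zero_smul, h2] at h3
    exact Subtype.ext h3
  · rintro rfl
    have h3 := gauge_smul a 0 0
    rw [zero_smul, zero_smul] at h3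
    exact Subtype.ext h3

theorem mem_floquetMultipliers_iff (hq : MemLp q ⊤ cellMeasure) (a : ℂ) :
    -Complex.exp a ∈ floquetMultipliers k q ↔
      ¬ ∀ u : V, u + lowerOrder ((memLp_multiplier hq k).toLp _) a (D 0 u) = 0 → u = 0 := by
  have hrhs : rhs ((MemLp.zero (p := 2) (μ := cellMeasure) (ε := ℂ)).toLp (0 : ℝ × ℝ → ℂ)) a = 0 := by
    have : (MemLp.zero (p := 2) (μ := cellMeasure) (ε := ℂ)).toLp (0 : ℝ × ℝ → ℂ) = 0 :=
      MemLp.toLp_zero _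
    rw [this, rhs]
    simp
  constructor
  · rintro ⟨-, w, hw0, hw⟩ h
    obtain ⟨u, rfl⟩ := hw.exists_gauge
    have := (isSolution_gauge_iff hq MemLp.zero a u).1 hw
    rw [hrhs] at this
    exact hw0 (gaugeH1_eq_zero_iff.2 (h u this))
  · intro h
    push Not at h
    obtain ⟨u, hu, hu0⟩ := h
    refine ⟨neg_ne_zero.2 (Complex.exp_ne_zero a), _, fun h0 => hu0 (gaugeH1_eq_zero_iff.1 h0),
      (isSolution_gauge_iff hq MemLp.zero a u).2 ?_⟩
    rw [hrhs, hu]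

end Bridge

/-! ### Returning from the exponent to the multiplier -/

/-- The local inverse of `a ↦ -exp a` at `z` with value `a` there. -/
theorem exists_local_log {z : ℂ} (hz : z ≠ 0) : ∃ ψ : ℂ → ℂ, AnalyticAt ℂ ψ z ∧
    ∀ y, y ≠ 0 → -Complex.exp (ψ y) = y := by
  -- Dividing by `z` puts the argument at `1` when `y = z`, away from the branch cut, whatever `z`
  -- is. The exponential identity needs no such care and holds for all `y ≠ 0`.
  refine ⟨fun y => Complex.log (-z) + Complex.log (y / z), ?_, fun y hy => ?_⟩
  · refine analyticAt_const.add (AnalyticAt.clog (analyticAt_id.div analyticAt_const hz) ?_)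
    simp [div_self hz]
  · rw [Complex.exp_add, Complex.exp_log (neg_ne_zero.2 hz), Complex.exp_log (div_ne_zero hy hz)]
    field_simp

/-- Having `-exp` as a left inverse, `ψ` is injective off zero and cannot return to `ψ z`. -/
theorem tendsto_punctured_of_local_log {z : ℂ} (hz : z ≠ 0) {ψ : ℂ → ℂ} (hψ : AnalyticAt ℂ ψ z)
    (h : ∀ y, y ≠ 0 → -Complex.exp (ψ y) = y) : Tendsto ψ (𝓝[≠] z) (𝓝[≠] (ψ z)) := by
  refine tendsto_nhdsWithin_iff.2 ⟨hψ.continuousAt.tendsto.mono_left nhdsWithin_le_nhds, ?_⟩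
  filter_upwards [self_mem_nhdsWithin, (eventually_ne_nhds hz).filter_mono nhdsWithin_le_nhds]
    with y hy hy0 hEq
  refine hy ?_
  rw [Set.mem_singleton_iff, ← h y hy0, ← h z hz, Set.mem_singleton_iff.1 hEq]

section

variable {k : ℝ} {q : ℝ × ℝ → ℝ} {f : ℝ × ℝ → ℂ}

theorem eventually_notMem_floquetMultipliers (hq : MemLp q ⊤ cellMeasure) {z : ℂ} (hz : z ≠ 0) :
    ∀ᶠ y in 𝓝[≠] z, y ∉ floquetMultipliers k q := by
  obtain ⟨ψ, hψ, h⟩ := exists_local_log hz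
  obtain ⟨a₁, h₁⟩ := exists_injective ((memLp_multiplier hq k).toLp _)
  have h2 := eventually_injective finiteRankApproximable_D (analyticAt_lowerOrder _) h₁ (ψ z)
  filter_upwards [(tendsto_punctured_of_local_log hz hψ h).eventually h2,
    (eventually_ne_nhds hz).filter_mono nhdsWithin_le_nhds] with y hy hy0
  rw [← h y hy0, mem_floquetMultipliers_iff hq, not_not]
  exact hy

theorem existsUnique_solution (hq : MemLp q ⊤ cellMeasure) (hf : MemLp f 2 cellMeasure) {z : ℂ}
    (hz0 : z ≠ 0) (hz : z ∉ floquetMultipliers k q) : ∃! w : H1, IsSolution k q f z w := by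
  obtain ⟨ψ, -, h⟩ := exists_local_log hz0
  rw [← h z hz0] at hz ⊢
  generalize ψ z = a at hz
  rw [mem_floquetMultipliers_iff hq, not_not] at hz
  obtain ⟨d, N, -, -, hdN⟩ := exists_analytic_cramer finiteRankApproximable_D
    (analyticAt_lowerOrder ((memLp_multiplier hq k).toLp _) a)
  obtain ⟨-, h2, h3⟩ := hdN.self_of_nhds
  have hd : d a ≠ 0 := fun h0 => by
    obtain ⟨u, hu, hu'⟩ := h3 h0
    exact hu (hz u hu')
  refine ⟨gaugeH1 a (toH1 ((d a)⁻¹ • N a (rhs (hf.toLp f) a))), ?_, ?_⟩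
  · refine (isSolution_gauge_iff hq hf a _).2 ?_
    rw [map_smul, map_smul, ← smul_add, h2, smul_smul, inv_mul_cancel₀ hd, one_smul]
  · intro w hw
    obtain ⟨u, rfl⟩ := hw.exists_gauge
    have h4 := (isSolution_gauge_iff hq hf a u).1 hw
    congr 2
    refine sub_eq_zero.1 (hz _ ?_)
    rw [map_sub, map_sub, map_smul, map_smul, sub_add_sub_comm, h4, ← smul_add, h2, smul_smul,
      inv_mul_cancel₀ hd, one_smul, sub_self]

/-- Near every `z ≠ 0`, solutions are quotients of an analytic function with values in `H¹` by an
analytic scalar function that vanishes at most at Floquet multipliers. -/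
theorem exists_analytic_quotient (hq : MemLp q ⊤ cellMeasure) (hf : MemLp f 2 cellMeasure) {z : ℂ}
    (hz : z ≠ 0) : ∃ (d : ℂ → ℂ) (W : ℂ → H1), AnalyticAt ℂ d z ∧ AnalyticAt ℂ W z ∧
      ∀ᶠ y in 𝓝 z, y ∉ floquetMultipliers k q →
        d y ≠ 0 ∧ ∀ w, IsSolution k q f y w → w = (d y)⁻¹ • W y := by
  obtain ⟨ψ, hψ, h⟩ := exists_local_log hz
  obtain ⟨d, N, hd, hN, hdN⟩ := exists_analytic_cramer finiteRankApproximable_D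
    (analyticAt_lowerOrder ((memLp_multiplier hq k).toLp _) (ψ z))
  let u : ℂ → V := fun y => N (ψ y) (rhs (hf.toLp f) (ψ y))
  have hu : AnalyticAt ℂ u z :=
    analyticAt_clm_apply (hN.comp hψ) ((analyticAt_rhs _ _).comp hψ)
  have hW : AnalyticAt ℂ (fun y => gauge (ψ y) (u y)) z :=
    analyticAt_gauge hψ ((V.subtypeL.analyticAt _).comp hu)
  -- Analyticity is available in the ambient space of triples. The orthogonal projection onto `H1`
  -- fixes these values and carries analyticity over to the subspace.
  have hproj : (fun y => gaugeH1 (ψ y) (toH1 (u y))) =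
      fun y => H1.orthogonalProjectionOnto (gauge (ψ y) (u y)) := by
    funext y
    exact (Submodule.orthogonalProjectionOnto_mem_subspace_eq_self (gaugeH1 (ψ y) (toH1 (u y)))).symm
  refine ⟨fun y => d (ψ y), fun y => gaugeH1 (ψ y) (toH1 (u y)), hd.comp hψ, ?_, ?_⟩
  · rw [hproj]
    exact (H1.orthogonalProjectionOnto.analyticAt _).comp hW
  · filter_upwards [hψ.continuousAt.eventually hdN, eventually_ne_nhds hz] with y hy hy0 hyF
    rw [← h y hy0, mem_floquetMultipliers_iff hq, not_not] at hyF
    have hdy : d (ψ y) ≠ 0 := fun h0 => by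
      obtain ⟨v, hv, hv'⟩ := hy.2.2 h0
      exact hv (hyF v hv')
    refine ⟨hdy, fun w hw => ?_⟩
    rw [← h y hy0] at hw
    obtain ⟨v, rfl⟩ := hw.exists_gauge
    have h1 := hy.1 v
    rw [(isSolution_gauge_iff hq hf (ψ y) v).1 hw] at h1
    rw [eq_inv_smul_iff₀ hdy]
    refine Subtype.ext ?_
    change d (ψ y) • gauge (ψ y) (v : Triple) = gauge (ψ y) (u y : Triple)
    rw [← gauge_smul, ← Submodule.coe_smul, h1]

end

end Waveguide

theorem mainTheorem2 (k : ℝ) (q : ℝ × ℝ → ℝ)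
    (hq : MemLp q ∞ (volume.restrict Waveguide.strip))
    (hq_per : ∀ n : ℤ, ∀ᵐ x ∂(volume.restrict Waveguide.strip), q (x.1 + n, x.2) = q x)
    (hq_pos : ∃ c : ℝ, 0 < c ∧ ∀ᵐ x ∂(volume.restrict Waveguide.strip), c ≤ q x)
    (f : ℝ × ℝ → ℂ) (hf : MemLp f 2 (volume.restrict Waveguide.strip))
    (hf_supp : ∀ᵐ x ∂(volume.restrict Waveguide.strip), x ∉ Waveguide.cell → f x = 0) :
    (∀ z : ℂ, z ∉ Waveguide.floquetMultipliers k q ∪ {0} →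
      ∃! w : Waveguide.H1, Waveguide.IsSolution k q f z w) ∧
    (∀ z : ℂ, z ≠ 0 → ∀ᶠ y in 𝓝[≠] z, y ∉ Waveguide.floquetMultipliers k q) ∧
    (∀ w : ℂ → Waveguide.H1,
      (∀ z : ℂ, z ∉ Waveguide.floquetMultipliers k q ∪ {0} →
        Waveguide.IsSolution k q f z (w z)) →
      AnalyticOnNhd ℂ w (Waveguide.floquetMultipliers k q ∪ {0})ᶜ ∧
      MeromorphicOn w {0}ᶜ) := by
  have hq' : MemLp q ⊤ Waveguide.cellMeasure :=
    hq.mono_measure (Measure.restrict_mono Waveguide.cell_subset_strip le_rfl)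
  have hf' : MemLp f 2 Waveguide.cellMeasure :=
    hf.mono_measure (Measure.restrict_mono Waveguide.cell_subset_strip le_rfl)
  have hdisc := fun (z : ℂ) (hz : z ≠ 0) =>
    Waveguide.eventually_notMem_floquetMultipliers (k := k) hq' hz
  refine ⟨fun z hz => ?_, hdisc, fun w hw => ⟨fun z hz => ?_, fun z hz => ?_⟩⟩
  · rw [Set.mem_union, not_or] at hz
    exact Waveguide.existsUnique_solution hq' hf' hz.2 hz.1
  · rw [Set.mem_compl_iff, Set.mem_union, not_or] at hz
    obtain ⟨d, W, hd, hW, h⟩ := Waveguide.exists_analytic_quotient (k := k) hq' hf' hz.2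
    have hF : ∀ᶠ y in 𝓝 z, y ∉ Waveguide.floquetMultipliers k q := by
      filter_upwards [eventually_nhdsWithin_iff.1 (hdisc z hz.2)] with y hy
      by_cases hyz : y = z
      · exact hyz ▸ hz.1
      · exact hy hyz
    refine ((hd.inv (h.self_of_nhds hz.1).1).smul hW).congr ?_
    filter_upwards [h, hF, eventually_ne_nhds hz.2] with y hy hyF hy0
    exact ((hy hyF).2 _ (hw y (by simp [hyF, hy0]))).symm
  -- Here `d z` may vanish, but the quotient formula holds on a punctured neighbourhood, which
  -- suffices for meromorphy.
  · obtain ⟨d, W, hd, hW, h⟩ := Waveguide.exists_analytic_quotient (k := k) hq' hf' hz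
    refine (hd.meromorphicAt.inv.smul hW.meromorphicAt).congr ?_
    filter_upwards [h.filter_mono nhdsWithin_le_nhds, hdisc z hz,
      (eventually_ne_nhds (show z ≠ 0 from hz)).filter_mono nhdsWithin_le_nhds] with y hy hyF hy0
    exact ((hy hyF).2 _ (hw y (by simp [hyF, hy0]))).symm
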